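/- Let $\varepsilon>0$. There is a constant $C>0$ depending only on $\varepsilon$ (possibly ineffective) such that the following holds. Let $\chi$ be a primitive quadratic Dirichlet character of conductor $q_\chi$ (quadratic meaning real-valued and non-principal) that has a Siegel zero $\beta$ of quality $\eta$, that is, $\eta\ge 10$ and $\beta$ are real numbers with $$L(\beta,\chi)=0,\qquad \beta = 1-\frac{1}{\eta\log q_\chi}.$$ Call a prime $p^*$ exceptional if $\chi(p^*)\neq -1$; the sums below run over exceptional primes $p^*$. (i) For every real $x\ge q_\chi^{(1+\varepsilon)/2}$, $$\sum_{q_\chi^{(1+\varepsilon)/2}<p^*\le x}\frac1{p^*}\le C\,\frac{\log_{q_\chi}x}{\eta},\qquad\text{where } \log_{q_\chi}x=\frac{\log x}{\log q_\chi}.$$ (ii) For every integer $m\ge 2$, $$\sum_{q_\chi^{(1+\varepsilon)/(2m)}<p^*\le q_\chi^{(1+\varepsilon)/(2(m-1))}}\frac1{p^*}\le C\,\frac{m}{\eta^{1/m}}.$$ -/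

import Mathlib

/-- `β` is a Siegel zero of quality `η` attached to the primitive quadratic Dirichlet character `χ`.
As `χ` is primitive, its conductor is its modulus `q`.  `MulChar.IsQuadratic` says that the
values of `χ` lie in `{0, 1, -1}`; with `χ ≠ 1` this means that `χ` has order exactly two. -/
structure IsSiegelZero {q : ℕ} [NeZero q] (χ : DirichletCharacter ℂ q) (η β : ℝ) : Prop where
  isPrimitive : χ.IsPrimitive
  isQuadratic : χ.IsQuadratic
  ne_one : χ ≠ 1
  ten_le_quality : 10 ≤ η
  eq_one_sub : β = 1 - 1 / (η * Real.log q)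
  LFunction_eq_zero : χ.LFunction (β : ℂ) = 0

/-- A prime `p` is exceptional for `χ` if `χ(p) ≠ -1`. -/
def IsExceptionalPrime {q : ℕ} (χ : DirichletCharacter ℂ q) (p : ℕ) : Prop :=
  p.Prime ∧ χ (p : ZMod q) ≠ -1

open Classical in
/-- The finite set of the exceptional primes `p` with `a < p ≤ b`. -/
noncomputable def exceptionalPrimesIoc {q : ℕ} (χ : DirichletCharacter ℂ q) (a b : ℝ) :
    Finset ℕ :=
  (Finset.Iic ⌊b⌋₊).filter (fun p => IsExceptionalPrime χ p ∧ a < (p : ℝ) ∧ (p : ℝ) ≤ b)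

/-- The truncation at `⌊b⌋₊` in the definition loses nothing. -/
theorem mem_exceptionalPrimesIoc {q : ℕ} (χ : DirichletCharacter ℂ q) (a b : ℝ) (p : ℕ) :
    p ∈ exceptionalPrimesIoc χ a b ↔ IsExceptionalPrime χ p ∧ a < (p : ℝ) ∧ (p : ℝ) ≤ b := by
  simp only [exceptionalPrimesIoc, Finset.mem_filter, Finset.mem_Iic, and_iff_right_iff_imp]
  exact fun h => Nat.le_floor h.2.2

/-! Let r = 1 * χ, which is nonnegative because χ is quadratic, let z = q^((1+ε)/2), and let T be
the sum of r(n)/n over n ≤ z (`partialSumZetaMul`). The proof plays two facts about r against each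
other.

First, r has little mass beyond z. By the hyperbola method, summing r(n) n^(-β) up to z gives a main
term of size L(1,χ)/(1-β), since L(β,χ) = 0 removes the competing term. As 1/(1-β) = η log q, this
yields η log q · |L(1,χ)| ≪ T (`abs_div_one_sub_le`). The hyperbola method at s = 1 shows that the
sum of r(n)/n over z^(k+1) < n ≤ z^(k+3) is about L(1,χ) · 2 log z (`sum_Ioc_mul_zeta_le`), hence is
O(T/η). The Pólya–Vinogradov inequality makes the errors a power of q smaller than 1, which is why z
must exceed √q by a power of q. They have to be compared with 1/(η log q), which needs Siegel's
bound η log q ≪ q^κ (`exists_quality_mul_log_le_rpow`), the source of the ineffective constant. All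
this is `exists_sum_Ioc_zetaMul_le`.

Second, r(pn) ≥ r(n) for an exceptional prime p. Multiplying each n ≤ z by k exceptional primes
whose product is between z^(j+1) and z^(j+2) therefore puts mass (∑ 1/p)^k · T into such a window,
up to the multiplicity of representations, which is at most w^k when an integer of the window has at
most w of these prime divisors (`sum_pow_mul_sum_le`). The factor T cancels, leaving (∑ 1/p)^k ≪
w^k/η. Part (i) takes k = 1 on consecutive windows; part (ii) takes k = m. -/

/-! ### Partial sums of n^(-s) and the hyperbola method for f * ζ. -/

open Finset in
/-- Comparison of `∑ m ^ (-s)` with the integral, at integers. -/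
theorem sum_rpow_neg_integral_bounds {s : ℝ} (hs : 0 < s) (N : ℕ) (hN : 1 ≤ N) :
    (∫ t in (N : ℝ)..(N + 1 : ℕ), t ^ (-s)) ≤ (N : ℝ) ^ (-s) ∧
      ((N + 1 : ℕ) : ℝ) ^ (-s) ≤ ∫ t in (N : ℝ)..(N + 1 : ℕ), t ^ (-s) := by
  have hN' : (0 : ℝ) < N := by exact_mod_cast hN
  have hint : IntervalIntegrable (fun t : ℝ => t ^ (-s)) MeasureTheory.volume (N : ℝ) (N + 1 : ℕ) := by
    refine intervalIntegral.intervalIntegrable_rpow (Or.inr ?_)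
    rw [Set.uIcc_of_le (by push_cast; linarith)]
    intro h; linarith [h.1]
  have hle : (N : ℝ) ≤ (N + 1 : ℕ) := by push_cast; linarith
  constructor
  · have := intervalIntegral.integral_mono_on hle hint
      (intervalIntegrable_const (c := (N : ℝ) ^ (-s)))
      (fun x hx => Real.rpow_le_rpow_of_nonpos hN' hx.1 (by linarith))
    simpa using this
  · have := intervalIntegral.integral_mono_on hle
      (intervalIntegrable_const (c := ((N + 1 : ℕ) : ℝ) ^ (-s))) hint
      (fun x hx => Real.rpow_le_rpow_of_nonpos (by linarith [hx.1]) hx.2 (by linarith))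
    simpa using this

theorem intervalIntegrable_rpow_neg {a b s : ℝ} (ha : 0 < a) (hb : 0 < b) :
    IntervalIntegrable (fun t : ℝ => t ^ (-s)) MeasureTheory.volume a b := by
  refine intervalIntegral.intervalIntegrable_rpow (Or.inr ?_)
  intro h
  rcases Set.mem_uIcc.1 h with h | h <;> linarith [h.1]

-- The integral is kept separate from γ so that γ stays in [0, 1] uniformly in s; a closed form
-- would bring in the term 1/(1-s), which blows up as s tends to 1.
open Finset in
theorem exists_sum_rpow_neg_approx {s : ℝ} (hs : 0 < s) (hs1 : s ≤ 1) :
    ∃ γ : ℝ, 0 ≤ γ ∧ γ ≤ 1 ∧ ∀ u : ℝ, 1 ≤ u →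
      |∑ m ∈ Ioc 0 ⌊u⌋₊, (m : ℝ) ^ (-s) - ((∫ t in (1 : ℝ)..u, t ^ (-s)) + γ)| ≤ 2 * u ^ (-s) := by
  -- `E` decreases while `E k` minus its last summand increases, so both squeeze the same limit γ.
  -- The shift by one starts the sequence at the endpoint 1.
  let E : ℕ → ℝ := fun k => ∑ m ∈ Ioc 0 (k + 1), (m : ℝ) ^ (-s) -
    ∫ t in (1 : ℝ)..((k + 1 : ℕ) : ℝ), t ^ (-s)
  have hstep (k : ℕ) : E (k + 1) = E k + (((k + 1 + 1 : ℕ) : ℝ) ^ (-s) -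
      ∫ t in ((k + 1 : ℕ) : ℝ)..((k + 1 + 1 : ℕ) : ℝ), t ^ (-s)) := by
    have h1 : (0 : ℝ) < ((k + 1 : ℕ) : ℝ) := by positivity
    have h2 : (0 : ℝ) < ((k + 1 + 1 : ℕ) : ℝ) := by positivity
    have := intervalIntegral.integral_add_adjacent_intervals
      (intervalIntegrable_rpow_neg (s := s) one_pos h1) (intervalIntegrable_rpow_neg (s := s) h1 h2)
    simp only [E]
    rw [sum_Ioc_succ_top (by omega), ← this]
    ring
  have hb (k : ℕ) := sum_rpow_neg_integral_bounds hs (k + 1) (by omega)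
  have hanti : Antitone E := antitone_nat_of_succ_le fun k => by
    rw [hstep]; linarith [(hb k).2]
  have hmono : Monotone fun k => E k - ((k + 1 : ℕ) : ℝ) ^ (-s) := monotone_nat_of_le_succ fun k => by
    simp only [hstep]; linarith [(hb k).1]
  have hE0 : E 0 = 1 := by simp [E]
  have hcross (j k : ℕ) : E j - ((j + 1 : ℕ) : ℝ) ^ (-s) ≤ E k := by
    have h1 := hmono (le_max_left j k)
    have h2 := hanti (le_max_right j k)
    have h3 : (0 : ℝ) ≤ ((max j k + 1 : ℕ) : ℝ) ^ (-s) := by positivity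
    simp only at h1
    linarith
  have hbdd : BddBelow (Set.range E) := ⟨E 0 - ((0 + 1 : ℕ) : ℝ) ^ (-s), by
    rintro _ ⟨k, rfl⟩; exact hcross 0 k⟩
  refine ⟨⨅ k, E k, ?_, ?_, ?_⟩
  · refine le_ciInf fun k => ?_
    have := hcross 0 k
    simpa [hE0] using this
  · exact (ciInf_le hbdd 0).trans hE0.le
  · intro u hu
    obtain ⟨k, hk⟩ : ∃ k, ⌊u⌋₊ = k + 1 :=
      ⟨⌊u⌋₊ - 1, by have := Nat.floor_pos.2 hu; omega⟩
    have hku : ((k + 1 : ℕ) : ℝ) ≤ u := hk ▸ Nat.floor_le (by linarith)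
    have huk : u < ((k + 1 : ℕ) : ℝ) + 1 := hk ▸ Nat.lt_floor_add_one u
    have hk0 : (0 : ℝ) < ((k + 1 : ℕ) : ℝ) := by positivity
    have h1 : (⨅ k, E k) ≤ E k := ciInf_le hbdd k
    have h2 : E k - ((k + 1 : ℕ) : ℝ) ^ (-s) ≤ ⨅ k, E k := le_ciInf fun j => hcross k j
    have hadd := intervalIntegral.integral_add_adjacent_intervals
      (intervalIntegrable_rpow_neg (s := s) one_pos hk0)
      (intervalIntegrable_rpow_neg (s := s) hk0 (show 0 < u by linarith))
    have h3 : 0 ≤ ∫ t in ((k + 1 : ℕ) : ℝ)..u, t ^ (-s) :=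
      intervalIntegral.integral_nonneg hku fun t ht => Real.rpow_nonneg (hk0.le.trans ht.1) _
    have h4 : (∫ t in ((k + 1 : ℕ) : ℝ)..u, t ^ (-s)) ≤ ((k + 1 : ℕ) : ℝ) ^ (-s) := by
      have := intervalIntegral.integral_mono_on hku
        (intervalIntegrable_rpow_neg (s := s) hk0 (show 0 < u by linarith))
        (intervalIntegrable_const (c := ((k + 1 : ℕ) : ℝ) ^ (-s)))
        (fun x hx => Real.rpow_le_rpow_of_nonpos hk0 hx.1 (by linarith))
      refine this.trans ?_
      rw [intervalIntegral.integral_const, smul_eq_mul]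
      have : (0 : ℝ) ≤ ((k + 1 : ℕ) : ℝ) ^ (-s) := by positivity
      nlinarith
    have h5 : ((k + 1 : ℕ) : ℝ) ^ (-s) ≤ 2 * u ^ (-s) := by
      have hk1 : (1 : ℝ) ≤ ((k + 1 : ℕ) : ℝ) := by push_cast; linarith [Nat.cast_nonneg (α := ℝ) k]
      have h6 : ((k + 1 : ℕ) : ℝ) ^ (-s) ≤ (u / 2) ^ (-s) :=
        Real.rpow_le_rpow_of_nonpos (by linarith) (by linarith) (by linarith)
      rw [Real.div_rpow (by linarith) (by norm_num), Real.rpow_neg (by norm_num : (0 : ℝ) ≤ 2),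
        div_inv_eq_mul] at h6
      have h7 : (2 : ℝ) ^ s ≤ 2 := by
        simpa using Real.rpow_le_rpow_of_exponent_le (by norm_num : (1 : ℝ) ≤ 2) hs1
      have : (0 : ℝ) ≤ u ^ (-s) := Real.rpow_nonneg (by linarith) _
      nlinarith
    have hEk : E k = ∑ m ∈ Ioc 0 ⌊u⌋₊, (m : ℝ) ^ (-s) - ∫ t in (1 : ℝ)..((k + 1 : ℕ) : ℝ), t ^ (-s) := by
      simp only [E, hk]
    rw [hEk] at h1 h2
    rw [abs_le]
    constructor <;> linarith

open Finset ArithmeticFunction in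
theorem sum_mul_zeta_mul_rpow (f : ArithmeticFunction ℝ) (s : ℝ) (Y : ℕ) :
    ∑ n ∈ Ioc 0 Y, (f * (zeta : ArithmeticFunction ℝ)) n * (n : ℝ) ^ (-s) =
      ∑ d ∈ Ioc 0 Y, f d * (d : ℝ) ^ (-s) * ∑ m ∈ Ioc 0 (Y / d), (m : ℝ) ^ (-s) := by
  let F : ArithmeticFunction ℝ := ⟨fun n => f n * (n : ℝ) ^ (-s), by simp⟩
  let G : ArithmeticFunction ℝ := ⟨fun n => if n = 0 then 0 else (n : ℝ) ^ (-s), by simp⟩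
  have h := sum_Ioc_mul_eq_sum_sum F G Y
  have hG (N : ℕ) : ∑ m ∈ Ioc 0 N, G m = ∑ m ∈ Ioc 0 N, (m : ℝ) ^ (-s) :=
    sum_congr rfl fun m hm => by
      have : m ≠ 0 := by have := (mem_Ioc.1 hm).1; omega
      simp [G, this]
  simp only [hG] at h
  rw [show (∑ d ∈ Ioc 0 Y, f d * (d : ℝ) ^ (-s) * ∑ m ∈ Ioc 0 (Y / d), (m : ℝ) ^ (-s)) =
    ∑ d ∈ Ioc 0 Y, F d * ∑ m ∈ Ioc 0 (Y / d), (m : ℝ) ^ (-s) from rfl, ← h]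
  refine sum_congr rfl fun n hn => ?_
  rw [mul_apply, mul_apply, sum_mul]
  refine sum_congr rfl fun x hx => ?_
  have hx' := Nat.mem_divisorsAntidiagonal.1 hx
  have h2 : x.2 ≠ 0 := by rintro h0; rw [h0] at hx'; exact hx'.2 (by simpa using hx'.1.symm)
  simp only [F, G, coe_mk, natCoe_apply, zeta_apply, h2, if_false, Nat.cast_one, mul_one]
  rw [← hx'.1, Nat.cast_mul, Real.mul_rpow (by positivity) (by positivity)]
  ring

open Finset in
/-- Dirichlet's hyperbola method. -/
theorem sum_mul_sum_div_eq_hyperbola (g h : ℕ → ℝ) {D Y : ℕ} (hDY : D ≤ Y) :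
    ∑ d ∈ Ioc 0 Y, g d * ∑ m ∈ Ioc 0 (Y / d), h m =
      ∑ d ∈ Ioc 0 D, g d * ∑ m ∈ Ioc 0 (Y / d), h m +
        ∑ m ∈ Ioc 0 Y, h m * ∑ d ∈ Ioc D (Y / m), g d := by
  rw [← sum_Ioc_consecutive _ (Nat.zero_le D) hDY]
  congr 1
  simp_rw [mul_sum]
  rw [sum_comm' (s' := fun m => Ioc D (Y / m)) (t' := Ioc 0 Y)]
  · exact sum_congr rfl fun m _ => sum_congr rfl fun d _ => mul_comm _ _
  · intro d m
    simp only [mem_Ioc]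
    constructor
    · rintro ⟨⟨h1, h2⟩, h3, h4⟩
      have := (Nat.le_div_iff_mul_le (by omega)).1 h4
      exact ⟨⟨h1, (Nat.le_div_iff_mul_le h3).2 (by linarith)⟩, h3, by nlinarith⟩
    · rintro ⟨⟨h1, h2⟩, h3, h4⟩
      have := (Nat.le_div_iff_mul_le h3).1 h2
      exact ⟨⟨h1, by nlinarith⟩, h3, (Nat.le_div_iff_mul_le (by omega)).2 (by linarith)⟩

-- For d ≤ D the inner sum is replaced by its integral, and each d costs 2 Y^(-s) whatever its size.
-- For d > D the order of summation is swapped, so that cancellation in the tail of f is available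
-- through K.
open Finset ArithmeticFunction in
theorem abs_sum_mul_zeta_sub_le (f : ArithmeticFunction ℝ) (hf : ∀ n, |f n| ≤ 1) {s γ K : ℝ}
    {D Y : ℕ} (hDY : D ≤ Y)
    (hγ : ∀ u : ℝ, 1 ≤ u →
      |∑ m ∈ Ioc 0 ⌊u⌋₊, (m : ℝ) ^ (-s) - ((∫ t in (1 : ℝ)..u, t ^ (-s)) + γ)| ≤ 2 * u ^ (-s))
    (hK : ∀ N, D ≤ N → |∑ d ∈ Ioc D N, f d * (d : ℝ) ^ (-s)| ≤ K) :
    |∑ n ∈ Ioc 0 Y, (f * (zeta : ArithmeticFunction ℝ)) n * (n : ℝ) ^ (-s) -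
      ∑ d ∈ Ioc 0 D, f d * (d : ℝ) ^ (-s) * ((∫ t in (1 : ℝ)..(Y / d : ℝ), t ^ (-s)) + γ)| ≤
      2 * D * (Y : ℝ) ^ (-s) + K * ∑ m ∈ Ioc 0 Y, (m : ℝ) ^ (-s) := by
  have hK0 : 0 ≤ K := by simpa using hK D le_rfl
  rw [sum_mul_zeta_mul_rpow, sum_mul_sum_div_eq_hyperbola (fun d => f d * (d : ℝ) ^ (-s)) _ hDY,
    add_sub_right_comm, ← sum_sub_distrib]
  refine (abs_add_le _ _).trans (add_le_add ?_ ?_)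
  · refine (abs_sum_le_sum_abs _ _).trans ?_
    have : ∀ d ∈ Ioc 0 D, |f d * (d : ℝ) ^ (-s) * ∑ m ∈ Ioc 0 (Y / d), (m : ℝ) ^ (-s) -
        f d * (d : ℝ) ^ (-s) * ((∫ t in (1 : ℝ)..(Y / d : ℝ), t ^ (-s)) + γ)| ≤
        2 * (Y : ℝ) ^ (-s) := by
      intro d hd
      obtain ⟨hd0, hdD⟩ := mem_Ioc.1 hd
      have hd0' : (0 : ℝ) < d := by exact_mod_cast hd0
      have hdY : (d : ℝ) ≤ Y := by exact_mod_cast hdD.trans hDY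
      have h1 := hγ (Y / d) ((one_le_div hd0').2 hdY)
      rw [Nat.floor_div_eq_div] at h1
      rw [← mul_sub, abs_mul, abs_mul, abs_of_nonneg (Real.rpow_nonneg hd0'.le _)]
      have h2 : (d : ℝ) ^ (-s) * (2 * (Y / d : ℝ) ^ (-s)) = 2 * (Y : ℝ) ^ (-s) := by
        have := Real.mul_rpow (x := (d : ℝ)) (y := Y / d) (z := -s) hd0'.le (by positivity)
        rw [mul_div_cancel₀ _ hd0'.ne'] at this
        rw [this]; ring
      rw [← h2, mul_assoc]
      calc _ ≤ 1 * _ := mul_le_mul_of_nonneg_right (hf d) (by positivity)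
        _ ≤ _ := by rw [one_mul]; gcongr
    refine (sum_le_sum this).trans ?_
    simp
    linarith
  · refine (abs_sum_le_sum_abs _ _).trans ?_
    rw [mul_sum]
    refine sum_le_sum fun m hm => ?_
    rw [abs_mul, abs_of_nonneg (by positivity), mul_comm]
    refine mul_le_mul_of_nonneg_right ?_ (by positivity)
    rcases le_total D (Y / m) with h | h
    · exact hK _ h
    · rw [Ioc_eq_empty (by omega)]; simpa using hK0

open Finset in
theorem sum_rpow_neg_one_le (Y : ℕ) : ∑ m ∈ Ioc 0 Y, (m : ℝ) ^ (-1 : ℝ) ≤ 1 + Real.log Y := by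
  have h := harmonic_le_one_add_log Y
  rw [harmonic_eq_sum_Icc] at h
  push_cast at h
  simp only [Real.rpow_neg_one]
  exact h

open Finset in
theorem rpow_neg_le_mul {β : ℝ} (hβ : β ≤ 1) {n Y : ℕ} (hn : 0 < n) (hnY : n ≤ Y) :
    (n : ℝ) ^ (-β) ≤ (Y : ℝ) ^ (1 - β) * (n : ℝ) ^ (-1 : ℝ) := by
  have hn' : (0 : ℝ) < n := by exact_mod_cast hn
  have : (n : ℝ) ^ (-β) = (n : ℝ) ^ (1 - β) * (n : ℝ) ^ (-1 : ℝ) := by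
    rw [← Real.rpow_add hn']; ring_nf
  rw [this]
  have : (n : ℝ) ^ (1 - β) ≤ (Y : ℝ) ^ (1 - β) :=
    Real.rpow_le_rpow hn'.le (by exact_mod_cast hnY) (by linarith)
  gcongr

open Finset in
theorem abs_sum_Ioc_le_two_mul {g : ℕ → ℝ} {D : ℕ} {L K : ℝ}
    (h : ∀ N, D ≤ N → |∑ d ∈ Ioc 0 N, g d - L| ≤ K) (N : ℕ) (hN : D ≤ N) :
    |∑ d ∈ Ioc D N, g d| ≤ 2 * K := by
  have h1 := h N hN
  have h2 := h D le_rfl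
  rw [← sum_Ioc_consecutive _ (Nat.zero_le D) hN] at h1
  rw [abs_le] at *
  constructor <;> linarith [h1.1, h1.2, h2.1, h2.2]

open Finset ArithmeticFunction in
/-- If the Dirichlet series of `f` vanishes at `β < 1`, then its value `L` at `1` is at most `1 - β`
times a partial sum of `(f * ζ)(n) / n`, up to a small error. -/
theorem abs_div_one_sub_le (f : ArithmeticFunction ℝ) (hf : ∀ n, |f n| ≤ 1)
    (hr : ∀ n, 0 ≤ (f * (zeta : ArithmeticFunction ℝ)) n) {β L K : ℝ}
    (hβ0 : 0 < β) (hβ1 : β < 1) {D Y : ℕ} (hD : 1 ≤ D) (hDY : D ≤ Y)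
    (h1 : ∀ N, D ≤ N → |∑ d ∈ Ioc 0 N, f d * (d : ℝ) ^ (-1 : ℝ) - L| ≤ K)
    (h2 : ∀ N, D ≤ N → |∑ d ∈ Ioc 0 N, f d * (d : ℝ) ^ (-β) - 0| ≤ K) :
    |L| / (1 - β) ≤ ∑ n ∈ Ioc 0 Y, (f * (zeta : ArithmeticFunction ℝ)) n * (n : ℝ) ^ (-1 : ℝ) +
      2 * K / (1 - β) + 2 * D / Y + 2 * K * (1 + Real.log Y) := by
  obtain ⟨γ, hγ0, hγ1, hγ⟩ := exists_sum_rpow_neg_approx hβ0 hβ1.le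
  have hK0 : 0 ≤ K := (abs_nonneg _).trans (h1 D le_rfl)
  have hmain := abs_sum_mul_zeta_sub_le f hf hDY hγ (abs_sum_Ioc_le_two_mul h2)
  have hY1 : (1 : ℝ) ≤ Y := by exact_mod_cast hD.trans hDY
  have hY0 : (0 : ℝ) < Y := by linarith
  have hD1 : (1 : ℝ) ≤ D := by exact_mod_cast hD
  set W : ℝ := (Y : ℝ) ^ (1 - β) with hW
  have hW1 : 1 ≤ W := Real.one_le_rpow hY1 (by linarith)
  set Q : ℝ := 1 / (1 - β) with hQ
  have hQ1 : 1 ≤ Q := by rw [hQ, le_div_iff₀ (by linarith)]; linarith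
  set T := ∑ n ∈ Ioc 0 Y, (f * (zeta : ArithmeticFunction ℝ)) n * (n : ℝ) ^ (-1 : ℝ) with hT
  -- Since d^(-β) (Y/d)^(1-β) = Y^(1-β)/d, the upper endpoint of the integral produces the series at
  -- 1. The lower endpoint produces the series at β, which is nearly zero.
  have hint : ∑ d ∈ Ioc 0 D, f d * (d : ℝ) ^ (-β) * ((∫ t in (1 : ℝ)..(Y / d : ℝ), t ^ (-β)) + γ) =
      Q * W * ∑ d ∈ Ioc 0 D, f d * (d : ℝ) ^ (-1 : ℝ) +
        (γ - Q) * ∑ d ∈ Ioc 0 D, f d * (d : ℝ) ^ (-β) := by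
    rw [mul_sum, mul_sum, ← sum_add_distrib]
    refine sum_congr rfl fun d hd => ?_
    have hd0 : (0 : ℝ) < d := by exact_mod_cast (mem_Ioc.1 hd).1
    rw [integral_rpow (Or.inl (by linarith))]
    have : (Y / d : ℝ) ^ (-β + 1) * (d : ℝ) ^ (-β) = W * (d : ℝ) ^ (-1 : ℝ) := by
      rw [Real.div_rpow hY0.le hd0.le, hW, show (-1 : ℝ) = -β - (-β + 1) by ring,
        Real.rpow_sub hd0, show -β + 1 = 1 - β by ring]
      ring
    have h3 : 1 - β ≠ 0 := by linarith
    rw [Real.one_rpow, hQ, show -β + 1 = 1 - β by ring] at *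
    field_simp
    linear_combination (f d) * this
  rw [hint] at hmain
  -- Passing from exponent β to exponent 1 costs the factor W, which the main term also carries; it
  -- is cancelled in `hfin`.
  have hTβ : ∑ n ∈ Ioc 0 Y, (f * (zeta : ArithmeticFunction ℝ)) n * (n : ℝ) ^ (-β) ≤ W * T := by
    rw [hT, mul_sum]
    refine sum_le_sum fun n hn => ?_
    obtain ⟨hn0, hnY⟩ := mem_Ioc.1 hn
    have := mul_le_mul_of_nonneg_left (rpow_neg_le_mul hβ1.le hn0 hnY) (hr n)
    linarith
  have hSβ : ∑ m ∈ Ioc 0 Y, (m : ℝ) ^ (-β) ≤ W * (1 + Real.log Y) := by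
    refine le_trans ?_ (mul_le_mul_of_nonneg_left (sum_rpow_neg_one_le Y) (by positivity))
    rw [mul_sum]
    exact sum_le_sum fun n hn => rpow_neg_le_mul hβ1.le (mem_Ioc.1 hn).1 (mem_Ioc.1 hn).2
  have hTβ0 : 0 ≤ ∑ n ∈ Ioc 0 Y, (f * (zeta : ArithmeticFunction ℝ)) n * (n : ℝ) ^ (-β) :=
    sum_nonneg fun n _ => mul_nonneg (hr n) (by positivity)
  have hYβ : (Y : ℝ) ^ (-β) = W / Y := by
    rw [hW, ← Real.rpow_sub_one hY0.ne']; ring_nf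
  have hl := h1 D le_rfl
  have hb := h2 D le_rfl
  rw [sub_zero] at hb
  set A := ∑ d ∈ Ioc 0 D, f d * (d : ℝ) ^ (-1 : ℝ)
  set Aβ := ∑ d ∈ Ioc 0 D, f d * (d : ℝ) ^ (-β)
  have hγQ : |(γ - Q) * Aβ| ≤ Q * K := by
    rw [abs_mul]
    have : |γ - Q| ≤ Q := by rw [abs_le]; constructor <;> linarith
    exact mul_le_mul this hb (abs_nonneg _) (by linarith)
  have hAL : |L| ≤ |A| + K := by
    have := abs_sub_abs_le_abs_sub L A
    rw [abs_sub_comm] at this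
    linarith
  have hQWA : Q * W * |A| ≤ W * T + Q * K + 2 * D * (W / Y) + 2 * K * (W * (1 + Real.log Y)) := by
    rw [hYβ] at hmain
    have h5 : Q * W * |A| = |Q * W * A| := by
      rw [abs_mul, abs_of_nonneg (by positivity : 0 ≤ Q * W)]
    have h6 : 2 * K * ∑ m ∈ Ioc 0 Y, (m : ℝ) ^ (-β) ≤ 2 * K * (W * (1 + Real.log Y)) := by gcongr
    rw [h5]
    rw [abs_le] at hmain hγQ
    rw [abs_le]
    constructor <;> linarith [hmain.1, hmain.2, hγQ.1, hγQ.2]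
  have hfin : W * (Q * |L|) ≤ W * (T + 2 * K * Q + 2 * D / Y + 2 * K * (1 + Real.log Y)) := by
    have h7 : Q * K ≤ W * (Q * K) := le_mul_of_one_le_left (by positivity) hW1
    have h8 : Q * W * |L| ≤ Q * W * (|A| + K) := by gcongr
    have h9 : 2 * D * (W / Y) = W * (2 * D / Y) := by ring
    linarith
  have := le_of_mul_le_mul_left hfin (by linarith)
  calc |L| / (1 - β) = Q * |L| := by rw [hQ]; ring
    _ ≤ _ := this
    _ = _ := by rw [hQ]; ring

-- The same cutoff D serves both endpoints, so γ and log d cancel in the difference of the main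
-- terms and only log(Y'/Y) times a partial sum for L remains.
open Finset ArithmeticFunction in
theorem sum_Ioc_mul_zeta_le (f : ArithmeticFunction ℝ) (hf : ∀ n, |f n| ≤ 1) {L K : ℝ}
    {D Y Y' : ℕ} (hD : 1 ≤ D) (hDY : D ≤ Y) (hYY : Y ≤ Y')
    (h1 : ∀ N, D ≤ N → |∑ d ∈ Ioc 0 N, f d * (d : ℝ) ^ (-1 : ℝ) - L| ≤ K) :
    ∑ n ∈ Ioc Y Y', (f * (zeta : ArithmeticFunction ℝ)) n * (n : ℝ) ^ (-1 : ℝ) ≤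
      Real.log (Y' / Y) * (|L| + K) + 4 * D / Y + 4 * K * (1 + Real.log Y') := by
  obtain ⟨γ, hγ0, hγ1, hγ⟩ := exists_sum_rpow_neg_approx one_pos le_rfl
  have hK0 : 0 ≤ K := (abs_nonneg _).trans (h1 D le_rfl)
  have hm1 := abs_sum_mul_zeta_sub_le f hf hDY hγ (abs_sum_Ioc_le_two_mul h1)
  have hm2 := abs_sum_mul_zeta_sub_le f hf (hDY.trans hYY) hγ (abs_sum_Ioc_le_two_mul h1)
  have hY1 : (1 : ℝ) ≤ Y := by exact_mod_cast hD.trans hDY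
  have hYY' : (Y : ℝ) ≤ Y' := by exact_mod_cast hYY
  have hint (d : ℕ) (hd : 0 < d) (Z : ℝ) (hZ : 0 < Z) :
      (∫ t in (1 : ℝ)..(Z / d : ℝ), t ^ (-1 : ℝ)) = Real.log (Z / d) := by
    have hd0 : (0 : ℝ) < d := by exact_mod_cast hd
    simp only [Real.rpow_neg_one]
    rw [integral_inv_of_pos one_pos (by positivity), div_one]
  have hdiff : ∑ d ∈ Ioc 0 D, f d * (d : ℝ) ^ (-1 : ℝ) * ((∫ t in (1 : ℝ)..(Y' / d : ℝ), t ^ (-1 : ℝ)) + γ) =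
      ∑ d ∈ Ioc 0 D, f d * (d : ℝ) ^ (-1 : ℝ) * ((∫ t in (1 : ℝ)..(Y / d : ℝ), t ^ (-1 : ℝ)) + γ) +
      Real.log (Y' / Y) * ∑ d ∈ Ioc 0 D, f d * (d : ℝ) ^ (-1 : ℝ) := by
    rw [mul_sum, ← sum_add_distrib]
    refine sum_congr rfl fun d hd => ?_
    have hd0 := (mem_Ioc.1 hd).1
    have hd0' : (0 : ℝ) < d := by exact_mod_cast hd0
    rw [hint d hd0 Y' (by linarith), hint d hd0 Y (by linarith), Real.log_div (by linarith) hd0'.ne',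
      Real.log_div (by linarith) hd0'.ne', Real.log_div (by linarith) (by linarith)]
    ring
  rw [hdiff] at hm2
  have hsplit := sum_Ioc_consecutive (fun n => (f * (zeta : ArithmeticFunction ℝ)) n * (n : ℝ) ^ (-1 : ℝ))
    (Nat.zero_le Y) hYY
  have hA := h1 D le_rfl
  have hlog : 0 ≤ Real.log (Y' / Y) := Real.log_nonneg ((one_le_div (by linarith)).2 hYY')
  have hLA : Real.log (Y' / Y) * ∑ d ∈ Ioc 0 D, f d * (d : ℝ) ^ (-1 : ℝ) ≤
      Real.log (Y' / Y) * (|L| + K) := by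
    refine mul_le_mul_of_nonneg_left ?_ hlog
    linarith [(abs_le.1 hA).2, le_abs_self L]
  have hl1 := mul_le_mul_of_nonneg_left (sum_rpow_neg_one_le Y) (by positivity : 0 ≤ 2 * K)
  have hl2 := mul_le_mul_of_nonneg_left (sum_rpow_neg_one_le Y') (by positivity : 0 ≤ 2 * K)
  have hl3 : 2 * K * (1 + Real.log Y) ≤ 2 * K * (1 + Real.log Y') := by gcongr
  have hi1 : 2 * (D : ℝ) * (Y' : ℝ) ^ (-1 : ℝ) ≤ 2 * (D : ℝ) / Y := by
    rw [Real.rpow_neg_one, ← div_eq_mul_inv]; gcongr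
  have hi2 : 2 * (D : ℝ) * (Y : ℝ) ^ (-1 : ℝ) = 2 * (D : ℝ) / Y := by
    rw [Real.rpow_neg_one, ← div_eq_mul_inv]
  have hi3 : 4 * (D : ℝ) / Y = 2 * (D : ℝ) / Y + 2 * (D : ℝ) / Y := by ring
  linarith [(abs_le.1 hm1).1, (abs_le.1 hm2).2]

/-! ### Integral representation and truncation of L(s, χ) for Re s > 0. -/

-- The integral is the Mellin transform at -s of a bounded step function vanishing on (0, 1), so
-- differentiability of Mellin transforms applies.
open Filter Asymptotics MeasureTheory in
theorem differentiableAt_integral_sum_mul_cpow (c : ℕ → ℂ) {B : ℝ}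
    (hB : ∀ N, ‖∑ k ∈ Finset.Icc 1 N, c k‖ ≤ B) {s : ℂ} (hs : 0 < s.re) :
    DifferentiableAt ℂ (fun s : ℂ => ∫ t in Set.Ioi (1 : ℝ),
      (∑ k ∈ Finset.Icc 1 ⌊t⌋₊, c k) * (t : ℂ) ^ (-(s + 1))) s := by
  let F : ℝ → ℂ := fun t => ∑ k ∈ Finset.Icc 1 ⌊t⌋₊, c k
  have hF0 (t : ℝ) (ht : t < 1) : F t = 0 := by
    simp [F, Nat.floor_eq_zero.2 ht]
  have hloc : LocallyIntegrableOn F (Set.Ioi 0) := by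
    have h := locallyIntegrableOn_mul_sum_Icc (𝕜 := ℂ) c (m := 1) (a := 0) le_rfl (g := fun _ => 1)
      (locallyIntegrableOn_const 1)
    simp only [one_mul] at h
    exact h.mono_set Set.Ioi_subset_Ici_self
  have htop : F =O[atTop] (fun t : ℝ => t ^ (-(0 : ℝ))) := by
    refine IsBigO.of_bound B (Eventually.of_forall fun t => ?_)
    simpa using hB ⌊t⌋₊
  have hd : DifferentiableAt ℂ (mellin F) (-s) := by
    refine mellin_differentiableAt_of_isBigO_rpow (a := 0) (b := (-s).re - 1) hloc htop (by simpa using hs)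
      ?_ (by linarith)
    refine IsBigO.of_bound 1 ?_
    filter_upwards [mem_nhdsWithin_of_mem_nhds (Iio_mem_nhds (one_pos : (0 : ℝ) < 1))] with t ht
    rw [hF0 t ht, norm_zero]
    positivity
  have hd' : DifferentiableAt ℂ (fun w => mellin F (-w)) s :=
    DifferentiableAt.comp (g := mellin F) (f := fun w => -w) s hd differentiableAt_id.neg
  convert hd' using 2 with w
  rw [mellin, ← Set.Ioc_union_Ioi_eq_Ioi (zero_le_one' ℝ), ← integral_indicator measurableSet_Ioi,
    ← integral_indicator (measurableSet_Ioc.union measurableSet_Ioi)]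
  refine integral_congr_ae ?_
  have h1 : ∀ᵐ t : ℝ, t ≠ 1 := by simp [ae_iff, measure_singleton]
  filter_upwards [h1] with t ht
  by_cases h : 1 < t
  · rw [Set.indicator_of_mem (by exact h), Set.indicator_of_mem (by exact Or.inr h), smul_eq_mul,
      mul_comm]
    congr 2
    ring
  · rw [Set.indicator_of_notMem (by exact h)]
    by_cases h' : t ∈ Set.Ioc (0 : ℝ) 1 ∪ Set.Ioi 1
    · rw [Set.indicator_of_mem h', hF0 t (lt_of_le_of_ne (not_lt.1 h) ht), smul_zero]
    · rw [Set.indicator_of_notMem h']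

theorem norm_sum_mul_cpow_le (c : ℕ → ℂ) {B : ℝ}
    (hB : ∀ N, ‖∑ k ∈ Finset.Icc 1 N, c k‖ ≤ B) (s : ℂ) {t : ℝ} (ht : 0 < t) :
    ‖(∑ k ∈ Finset.Icc 1 ⌊t⌋₊, c k) * (t : ℂ) ^ (-(s + 1))‖ ≤ B * t ^ (-s.re - 1) := by
  rw [norm_mul, Complex.norm_cpow_eq_rpow_re_of_pos ht,
    show (-(s + 1)).re = -s.re - 1 by simp; ring]
  exact mul_le_mul_of_nonneg_right (hB _) (by positivity)

open MeasureTheory in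
theorem integrableOn_sum_mul_cpow (c : ℕ → ℂ) {B : ℝ}
    (hB : ∀ N, ‖∑ k ∈ Finset.Icc 1 N, c k‖ ≤ B) {s : ℂ} (hs : 0 < s.re) {a : ℝ} (ha : 0 < a) :
    IntegrableOn (fun t : ℝ => (∑ k ∈ Finset.Icc 1 ⌊t⌋₊, c k) * (t : ℂ) ^ (-(s + 1))) (Set.Ioi a) := by
  have hdom : IntegrableOn (fun t : ℝ => B * t ^ (-s.re - 1)) (Set.Ioi a) :=
    (integrableOn_Ioi_rpow_of_lt (by linarith) ha).const_mul B
  refine Integrable.mono' hdom ?_ ?_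
  · have h := locallyIntegrableOn_mul_sum_Icc (𝕜 := ℂ) c (m := 1) (a := a) ha.le
      (g := fun t => (t : ℂ) ^ (-(s + 1))) ?_
    · simp_rw [mul_comm _ ((_ : ℂ) ^ (-(s + 1)))]
      exact (h.mono_set Set.Ioi_subset_Ici_self).aestronglyMeasurable
    · refine ContinuousOn.locallyIntegrableOn (fun t ht => ?_) measurableSet_Ici
      exact (Complex.continuousAt_ofReal_cpow_const _ _
        (Or.inr (ha.trans_le ht).ne')).continuousWithinAt
  · filter_upwards [ae_restrict_mem measurableSet_Ioi] with t ht
    exact norm_sum_mul_cpow_le c hB s (ha.trans ht)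

open MeasureTheory in
theorem norm_integral_sum_mul_cpow_le (c : ℕ → ℂ) {B : ℝ}
    (hB : ∀ N, ‖∑ k ∈ Finset.Icc 1 N, c k‖ ≤ B) {s : ℂ} (hs : 0 < s.re) {a : ℝ} (ha : 0 < a) :
    ‖∫ t in Set.Ioi a, (∑ k ∈ Finset.Icc 1 ⌊t⌋₊, c k) * (t : ℂ) ^ (-(s + 1))‖ ≤
      B * a ^ (-s.re) / s.re := by
  have hdom : IntegrableOn (fun t : ℝ => B * t ^ (-s.re - 1)) (Set.Ioi a) :=
    (integrableOn_Ioi_rpow_of_lt (by linarith) ha).const_mul B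
  refine (norm_integral_le_of_norm_le hdom ?_).trans ?_
  · filter_upwards [ae_restrict_mem measurableSet_Ioi] with t ht
    exact norm_sum_mul_cpow_le c hB s (ha.trans ht)
  · rw [integral_const_mul, integral_Ioi_rpow_of_lt (by linarith) ha]
    apply le_of_eq
    rw [sub_add_cancel]
    field_simp

namespace DirichletCharacter

variable {q : ℕ} [NeZero q]

-- Abel summation gives the identity for Re s > 1; both sides are analytic on Re s > 0, so it
-- persists there.
open Filter Asymptotics MeasureTheory in
theorem LFunction_eq_mul_integral {χ : DirichletCharacter ℂ q} (hχ : χ ≠ 1) {B : ℝ}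
    (hB : ∀ N : ℕ, ‖∑ k ∈ Finset.Icc 1 N, χ k‖ ≤ B) {s : ℂ} (hs : 0 < s.re) :
    χ.LFunction s = s * ∫ t in Set.Ioi (1 : ℝ),
      (∑ k ∈ Finset.Icc 1 ⌊t⌋₊, χ k) * (t : ℂ) ^ (-(s + 1)) := by
  let U : Set ℂ := {s : ℂ | 0 < s.re}
  have hU : IsOpen U := isOpen_lt continuous_const Complex.continuous_re
  have hUc : IsPreconnected U := (convex_halfSpace_re_gt 0).isPreconnected
  let R : ℂ → ℂ := fun s => s * ∫ t in Set.Ioi (1 : ℝ),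
      (∑ k ∈ Finset.Icc 1 ⌊t⌋₊, χ k) * (t : ℂ) ^ (-(s + 1))
  have hR : AnalyticOnNhd ℂ R U := by
    refine DifferentiableOn.analyticOnNhd (fun s hs => ?_) hU
    exact (differentiableAt_id.mul
      (differentiableAt_integral_sum_mul_cpow (fun k : ℕ => χ k) hB hs)).differentiableWithinAt
  have hL : AnalyticOnNhd ℂ χ.LFunction U :=
    DifferentiableOn.analyticOnNhd (differentiable_LFunction hχ).differentiableOn hU
  refine hL.eqOn_of_preconnected_of_eventuallyEq hR hUc (z₀ := 2) (by simp [U]) ?_ hs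
  have : {z : ℂ | 1 < z.re} ∈ nhds (2 : ℂ) :=
    (isOpen_lt continuous_const Complex.continuous_re).mem_nhds (by simp)
  filter_upwards [this] with z hz
  rw [LFunction_eq_LSeries χ hz]
  refine LSeries_eq_mul_integral _ le_rfl (zero_lt_one.trans hz)
    (LSeriesSummable_of_one_lt_re χ hz) ?_
  refine IsBigO.of_bound B (Eventually.of_forall fun N => ?_)
  simpa using hB N

theorem norm_LFunction_le_of_sum_le {χ : DirichletCharacter ℂ q} (hχ : χ ≠ 1) {B : ℝ}
    (hB : ∀ N : ℕ, ‖∑ k ∈ Finset.Icc 1 N, χ k‖ ≤ B) {s : ℂ} (hs : 0 < s.re) :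
    ‖χ.LFunction s‖ ≤ ‖s‖ * (B / s.re) := by
  rw [LFunction_eq_mul_integral hχ hB hs, norm_mul]
  have := norm_integral_sum_mul_cpow_le (fun k : ℕ => χ k) hB hs one_pos
  rw [Real.one_rpow, mul_one] at this
  gcongr

open MeasureTheory in
/-- Truncation of the Dirichlet series of a nontrivial character at a real point. -/
theorem norm_sum_mul_cpow_sub_LFunction_le {χ : DirichletCharacter ℂ q} (hχ : χ ≠ 1) {B : ℝ}
    (hB : ∀ N : ℕ, ‖∑ k ∈ Finset.Icc 1 N, χ k‖ ≤ B) {s : ℝ} (hs : 0 < s) {N : ℕ} (hN : 1 ≤ N) :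
    ‖∑ k ∈ Finset.Ioc 0 N, χ k * (k : ℂ) ^ (-(s : ℂ)) - χ.LFunction s‖ ≤ 2 * B * (N : ℝ) ^ (-s) := by
  have hq : q ≠ 1 := fun h => hχ (level_one' χ h)
  have hχ0 : χ ((0 : ℕ) : ZMod q) = 0 := by simpa using map_zero' χ hq
  have hs' : 0 < (s : ℂ).re := by simpa using hs
  have hsC : (s : ℂ) ≠ 0 := by exact_mod_cast hs.ne'
  have hN1 : (1 : ℝ) ≤ N := by exact_mod_cast hN
  have hIcc (M : ℕ) : ∑ k ∈ Finset.Icc 0 M, χ k = ∑ k ∈ Finset.Icc 1 M, χ k := by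
    rw [← Finset.insert_Icc_add_one_left_eq_Icc (Nat.zero_le M), Finset.sum_insert (by simp), hχ0, zero_add,
      zero_add]
  have hderiv (t : ℝ) (ht : 0 < t) : HasDerivAt (fun t : ℝ => (t : ℂ) ^ (-(s : ℂ)))
      (-(s : ℂ) * (t : ℂ) ^ (-(s : ℂ) - 1)) t :=
    hasDerivAt_ofReal_cpow_const ht.ne' (neg_ne_zero.2 hsC)
  -- After Abel summation the difference from L(s, χ) consists of the boundary term at N and the
  -- tail of the integral, each at most B N^(-s).
  have habel := sum_mul_eq_sub_integral_mul₀' (𝕜 := ℂ) (c := fun k : ℕ => χ k)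
    (f := fun t : ℝ => (t : ℂ) ^ (-(s : ℂ))) hχ0 N
    (fun t ht => (hderiv t (zero_lt_one.trans_le ht.1)).differentiableAt) ?_
  swap
  · refine ContinuousOn.integrableOn_Icc ?_
    refine ContinuousOn.congr (f := fun t : ℝ => -(s : ℂ) * (t : ℂ) ^ (-(s : ℂ) - 1)) ?_
      fun t ht => (hderiv t (zero_lt_one.trans_le ht.1)).deriv
    refine continuousOn_const.mul fun t ht => ?_
    exact (Complex.continuousAt_ofReal_cpow_const _ _
        (Or.inr (zero_lt_one.trans_le ht.1).ne')).continuousWithinAt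
  have hLHS : ∑ k ∈ Finset.Icc 0 N, (((k : ℝ) : ℂ)) ^ (-(s : ℂ)) * χ k =
      ∑ k ∈ Finset.Ioc 0 N, χ k * (k : ℂ) ^ (-(s : ℂ)) := by
    rw [← Finset.insert_Icc_add_one_left_eq_Icc (Nat.zero_le N), Finset.sum_insert (by simp), hχ0, mul_zero, zero_add]
    exact Finset.sum_congr rfl fun k _ => by rw [mul_comm]; simp
  have hintegral : ∫ t in Set.Ioc (1 : ℝ) N, deriv (fun t : ℝ => (t : ℂ) ^ (-(s : ℂ))) t *
      ∑ k ∈ Finset.Icc 0 ⌊t⌋₊, χ k = -(s : ℂ) * ∫ t in Set.Ioc (1 : ℝ) N,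
      (∑ k ∈ Finset.Icc 1 ⌊t⌋₊, χ k) * (t : ℂ) ^ (-((s : ℂ) + 1)) := by
    rw [← integral_const_mul]
    refine setIntegral_congr_fun measurableSet_Ioc fun t ht => ?_
    rw [(hderiv t (zero_lt_one.trans ht.1)).deriv, hIcc, neg_add']
    ring
  rw [hLHS, hintegral, hIcc] at habel
  rw [habel, LFunction_eq_mul_integral hχ hB hs']
  have hi := integrableOn_sum_mul_cpow (fun k : ℕ => χ k) hB hs' one_pos
  have hsplit := setIntegral_union (μ := volume) (Set.Ioc_disjoint_Ioi_same (a := (1 : ℝ)) (b := (N : ℝ)))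
    measurableSet_Ioi (hi.mono_set Set.Ioc_subset_Ioi_self) (hi.mono_set (Set.Ioi_subset_Ioi hN1))
  rw [Set.Ioc_union_Ioi_eq_Ioi hN1] at hsplit
  rw [hsplit]
  have hb := norm_integral_sum_mul_cpow_le (fun k : ℕ => χ k) hB hs' (zero_lt_one.trans_le hN1)
  rw [Complex.ofReal_re] at hb
  set J := ∫ t in Set.Ioi (N : ℝ), (∑ k ∈ Finset.Icc 1 ⌊t⌋₊, χ k) * (t : ℂ) ^ (-((s : ℂ) + 1))
  set I := ∫ t in Set.Ioc (1 : ℝ) N, (∑ k ∈ Finset.Icc 1 ⌊t⌋₊, χ k) * (t : ℂ) ^ (-((s : ℂ) + 1))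
  have : ((N : ℝ) : ℂ) ^ (-(s : ℂ)) * ∑ k ∈ Finset.Icc 1 N, χ k - -(s : ℂ) * I - s * (I + J) =
      ((N : ℝ) : ℂ) ^ (-(s : ℂ)) * ∑ k ∈ Finset.Icc 1 N, χ k - s * J := by ring
  rw [this]
  refine (norm_sub_le _ _).trans ?_
  rw [norm_mul, norm_mul, Complex.norm_cpow_eq_rpow_re_of_pos (by linarith), Complex.norm_real,
    Real.norm_of_nonneg hs.le]
  simp only [Complex.neg_re, Complex.ofReal_re]
  have h1 : s * ‖J‖ ≤ s * (B * (N : ℝ) ^ (-s) / s) := by gcongr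
  have h2 : s * (B * (N : ℝ) ^ (-s) / s) = B * (N : ℝ) ^ (-s) := by field_simp
  have h3 : (N : ℝ) ^ (-s) * ‖∑ k ∈ Finset.Icc 1 N, χ k‖ ≤ (N : ℝ) ^ (-s) * B := by
    gcongr
    exact hB N
  linarith

end DirichletCharacter

/-! ### Bounds for character sums. -/

theorem ZMod.sum_eq_sum_range {M : Type*} [AddCommMonoid M] {q : ℕ} [NeZero q] (g : ZMod q → M) :
    ∑ k, g k = ∑ k ∈ Finset.range q, g k := by
  refine Finset.sum_nbij' ZMod.val (fun k => (k : ZMod q)) ?_ ?_ ?_ ?_ ?_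
  · intro a _; simpa using ZMod.val_lt a
  · simp
  · simp
  · intro a ha; exact ZMod.val_cast_of_lt (by simpa using ha)
  · simp

theorem norm_sum_pow_le_two_div {ζ : ℂ} (hζ : ‖ζ‖ = 1) (h1 : ζ ≠ 1) (N : ℕ) :
    ‖∑ n ∈ Finset.Icc 1 N, ζ ^ n‖ ≤ 2 / ‖ζ - 1‖ := by
  have : ∑ n ∈ Finset.Icc 1 N, ζ ^ n = ζ * ((ζ ^ N - 1) / (ζ - 1)) := by
    rw [← geom_sum_eq h1, Finset.mul_sum, Finset.range_eq_Ico, ← Finset.Ico_add_one_right_eq_Icc]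
    rw [Finset.sum_Ico_eq_sum_range, Finset.sum_Ico_eq_sum_range]
    exact Finset.sum_congr (by simp) fun k _ => by rw [zero_add, add_comm, pow_succ']
  rw [this, norm_mul, hζ, one_mul, norm_div]
  gcongr
  calc _ ≤ ‖ζ ^ N‖ + ‖(1 : ℂ)‖ := norm_sub_le _ _
    _ = 2 := by rw [norm_pow, hζ]; norm_num

/-- The distance from e(k/q) to 1 is 2 sin(πk/q), and Jordan's inequality is applied at the nearer
of the ends 0 and q. The symmetric bound makes the sum over k two copies of one harmonic sum. -/
theorem norm_stdAddChar_sub_one_ge {q k : ℕ} [NeZero q] (hk0 : 0 < k) (hkq : k < q) :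
    2 / ‖ZMod.stdAddChar ((k : ZMod q)) - 1‖ ≤ (q / 2 : ℝ) * (1 / k + 1 / (q - k)) ∧
      ZMod.stdAddChar ((k : ZMod q)) ≠ 1 := by
  have hk0' : (0 : ℝ) < k := by exact_mod_cast hk0
  have hkq' : (k : ℝ) < q := by exact_mod_cast hkq
  have hq0 : (0 : ℝ) < q := by linarith
  have hpi := Real.pi_pos
  have hval : ZMod.stdAddChar ((k : ZMod q)) = Complex.exp (Complex.I * ((2 * Real.pi * k / q : ℝ) : ℂ)) := by
    have := ZMod.stdAddChar_coe (N := q) (k : ℤ)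
    simp only [Int.cast_natCast] at this
    rw [this]
    congr 1
    push_cast
    ring
  have hsin : 0 < Real.sin (Real.pi * k / q) := by
    refine Real.sin_pos_of_pos_of_lt_pi (by positivity) ?_
    rw [div_lt_iff₀ hq0]; gcongr
  have hnorm : ‖ZMod.stdAddChar ((k : ZMod q)) - 1‖ = 2 * Real.sin (Real.pi * k / q) := by
    rw [hval, Complex.norm_exp_I_mul_ofReal_sub_one,
      show 2 * Real.pi * k / q / 2 = Real.pi * k / q by ring, Real.norm_of_nonneg (by positivity)]
  refine ⟨?_, fun h => ?_⟩
  · rw [hnorm]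
    have hqk : (0 : ℝ) < q - k := by linarith
    have key : (1 : ℝ) / Real.sin (Real.pi * k / q) ≤ (q / 2 : ℝ) * (1 / k + 1 / (q - k)) := by
      rcases le_total (2 * (k : ℝ)) q with h | h
      · have h1 : 2 / Real.pi * (Real.pi * k / q) ≤ Real.sin (Real.pi * k / q) :=
          Real.mul_le_sin (by positivity) (by rw [div_le_div_iff₀ hq0 two_pos]; nlinarith)
        have h2 : 2 / Real.pi * (Real.pi * k / q) = 2 * k / q := by field_simp
        rw [h2] at h1
        calc _ ≤ 1 / (2 * k / q : ℝ) := by gcongr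
          _ = (q / 2 : ℝ) * (1 / k) := by field_simp
          _ ≤ _ := by
            have : (0 : ℝ) ≤ 1 / (q - k) := by positivity
            gcongr; linarith
      · have h1 : 2 / Real.pi * (Real.pi * (q - k) / q) ≤ Real.sin (Real.pi * (q - k) / q) :=
          Real.mul_le_sin (by positivity) (by rw [div_le_div_iff₀ hq0 two_pos]; nlinarith)
        have h2 : 2 / Real.pi * (Real.pi * (q - k) / q) = 2 * (q - k) / q := by field_simp
        have h3 : Real.sin (Real.pi * (q - k) / q) = Real.sin (Real.pi * k / q) := by
          rw [← Real.sin_pi_sub]; congr 1; field_simp; ring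
        rw [h2, h3] at h1
        calc _ ≤ 1 / (2 * (q - k) / q : ℝ) := by gcongr
          _ = (q / 2 : ℝ) * (1 / (q - k)) := by field_simp
          _ ≤ _ := by
            have : (0 : ℝ) ≤ 1 / k := by positivity
            gcongr; linarith
    calc _ = (1 : ℝ) / Real.sin (Real.pi * k / q) := by field_simp
      _ ≤ _ := key
  · rw [h] at hnorm
    simp only [sub_self, norm_zero] at hnorm
    linarith

namespace DirichletCharacter
variable {q : ℕ} [NeZero q]

/-- A primitive quadratic χ is turned by the Fourier transform into its Gauss sum times χ(-k).
Transforming twice gives the square of the Gauss sum, while Fourier inversion gives q χ(-1). -/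
theorem norm_gaussSum_sq_of_isQuadratic {χ : DirichletCharacter ℂ q} (hp : χ.IsPrimitive)
    (hχ : χ.IsQuadratic) : ‖gaussSum χ ZMod.stdAddChar‖ ^ 2 = q := by
  have h1 : ZMod.dft (ZMod.dft χ) 1 = gaussSum χ ZMod.stdAddChar ^ 2 := by
    have : (ZMod.dft χ : ZMod q → ℂ) = fun k => gaussSum χ ZMod.stdAddChar * χ (-k) := by
      ext k
      rw [hp.fourierTransform_eq_inv_mul_gaussSum, hχ.inv, mul_comm]
    rw [this, ZMod.dft_const_mul, ZMod.dft_comp_neg]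
    beta_reduce
    rw [hp.fourierTransform_eq_inv_mul_gaussSum]
    simp [sq]
  rw [ZMod.dft_dft] at h1
  beta_reduce at h1
  have h2 : ‖χ (-1)‖ = 1 := by
    have : χ (-1) * χ (-1) = 1 := by rw [← map_mul]; simp
    have h3 : ‖χ (-1)‖ * ‖χ (-1)‖ = 1 := by rw [← norm_mul, this, norm_one]
    nlinarith [norm_nonneg (χ (-1))]
  rw [← norm_pow, ← h1, smul_eq_mul, norm_mul, h2]
  simp

/-- The Pólya–Vinogradov inequality for quadratic characters. -/
theorem norm_sum_Icc_le_of_isPrimitive {χ : DirichletCharacter ℂ q} (hp : χ.IsPrimitive)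
    (hχ : χ.IsQuadratic) (h1 : χ ≠ 1) (N : ℕ) :
    ‖∑ n ∈ Finset.Icc 1 N, χ n‖ ≤ √q * (1 + Real.log q) := by
  have hq0 : (0 : ℝ) < q := by exact_mod_cast Nat.pos_of_neZero q
  have hqC : (q : ℂ) ≠ 0 := by exact_mod_cast hq0.ne'
  set τ := gaussSum χ ZMod.stdAddChar with hτ
  have hτn : ‖τ‖ = √q := by
    rw [← norm_gaussSum_sq_of_isQuadratic hp hχ, Real.sqrt_sq (norm_nonneg _)]
  -- Fourier inversion: χ becomes a combination of additive characters, whose partial sums are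
  -- geometric.
  have hexp (n : ℕ) : χ n = (q : ℂ)⁻¹ * ∑ k : ZMod q, ZMod.stdAddChar (k * (n : ZMod q)) * (χ (-k) * τ) := by
    have h := congr_fun (ZMod.dft_dft (χ : ZMod q → ℂ)) (-(n : ZMod q))
    rw [ZMod.dft_apply] at h
    simp only [neg_neg, smul_eq_mul, mul_neg, hp.fourierTransform_eq_inv_mul_gaussSum, hχ.inv] at h
    rw [h, inv_mul_cancel_left₀ hqC]
  have hsum : ∑ n ∈ Finset.Icc 1 N, χ n =
      (q : ℂ)⁻¹ * ∑ k : ZMod q, χ (-k) * τ * ∑ n ∈ Finset.Icc 1 N, ZMod.stdAddChar k ^ n := by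
    simp_rw [Finset.mul_sum]
    rw [Finset.sum_comm]
    refine Finset.sum_congr rfl fun n _ => ?_
    rw [hexp n, Finset.mul_sum]
    refine Finset.sum_congr rfl fun k _ => ?_
    rw [← AddChar.map_nsmul_eq_pow, nsmul_eq_mul, mul_comm (n : ZMod q)]
    ring
  have hχ0 : χ 0 = 0 := map_zero' χ fun h => h1 (level_one' χ h)
  rw [hsum, norm_mul, norm_inv, Complex.norm_natCast, ZMod.sum_eq_sum_range]
  have hterm : ∀ k ∈ Finset.range q, ‖χ (-(k : ZMod q)) * τ *
      ∑ n ∈ Finset.Icc 1 N, ZMod.stdAddChar (k : ZMod q) ^ n‖ ≤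
      √q * ((q / 2 : ℝ) * if k = 0 then 0 else (1 / k + 1 / (q - k) : ℝ)) := by
    intro k hk
    rcases Nat.eq_zero_or_pos k with rfl | hk0
    · simp [hχ0]
    · obtain ⟨h2, h3⟩ := norm_stdAddChar_sub_one_ge hk0 (Finset.mem_range.1 hk)
      rw [norm_mul, norm_mul, hτn, if_neg hk0.ne']
      have h4 := norm_sum_pow_le_two_div (AddChar.norm_apply _ _) h3 N
      calc _ ≤ 1 * √q * _ := by gcongr; exact χ.norm_le_one _
        _ ≤ √q * _ := by rw [one_mul]; gcongr; exact h4.trans h2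
  have hH : ∑ k ∈ Finset.range q, (if k = 0 then 0 else (1 / k + 1 / (q - k) : ℝ)) ≤
      2 * (1 + Real.log q) := by
    obtain ⟨p, rfl⟩ : ∃ p, q = p + 1 := ⟨q - 1, by have := Nat.pos_of_neZero q; omega⟩
    rw [Finset.sum_range_succ']
    simp only [Nat.add_eq_zero_iff, one_ne_zero, and_false, if_false, if_true, add_zero]
    rw [Finset.sum_add_distrib]
    have hr : ∑ k ∈ Finset.range p, (1 : ℝ) / (((p + 1 : ℕ) : ℝ) - ((k + 1 : ℕ) : ℝ)) =
        ∑ k ∈ Finset.range p, (1 : ℝ) / ((k + 1 : ℕ) : ℝ) := by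
      rw [← Finset.sum_range_reflect]
      refine Finset.sum_congr rfl fun k hk => ?_
      have hk' := Finset.mem_range.1 hk
      congr 1
      rw [Nat.sub_sub, Nat.add_comm 1 k]
      push_cast [Nat.cast_sub (show k + 1 ≤ p by omega)]
      ring
    rw [hr]
    have hh := harmonic_le_one_add_log p
    rw [harmonic] at hh
    push_cast at hh
    have : ∑ k ∈ Finset.range p, (1 : ℝ) / ((k + 1 : ℕ) : ℝ) ≤ 1 + Real.log p := by
      simpa using hh
    have hlog : Real.log p ≤ Real.log (p + 1 : ℕ) := by
      rcases Nat.eq_zero_or_pos p with rfl | hp0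
      · simp
      · exact Real.log_le_log (by exact_mod_cast hp0) (by push_cast; linarith)
    linarith
  calc _ ≤ (q : ℝ)⁻¹ * ∑ k ∈ Finset.range q,
        √q * ((q / 2 : ℝ) * if k = 0 then 0 else (1 / k + 1 / (q - k) : ℝ)) := by
        gcongr
        exact (norm_sum_le _ _).trans (Finset.sum_le_sum hterm)
    _ = √q * (1 / 2 * ∑ k ∈ Finset.range q, (if k = 0 then 0 else (1 / k + 1 / (q - k) : ℝ))) := by
        rw [← Finset.mul_sum, ← Finset.mul_sum]; field_simp
    _ ≤ √q * (1 / 2 * (2 * (1 + Real.log q))) := by gcongr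
    _ = _ := by ring

/-- The trivial bound for the partial sums of a nontrivial character. -/
theorem norm_sum_Icc_le_modulus {χ : DirichletCharacter ℂ q} (hχ : χ ≠ 1) (N : ℕ) :
    ‖∑ n ∈ Finset.Icc 1 N, χ n‖ ≤ q := by
  have hq0 : 0 < q := Nat.pos_of_neZero q
  have hχ0 : χ ((0 : ℕ) : ZMod q) = 0 := by
    simpa using map_zero' χ fun h => hχ (level_one' χ h)
  have hper : ∀ M : ℕ, ∑ n ∈ Finset.range (M + q), χ n = ∑ n ∈ Finset.range M, χ n := by
    intro M
    induction M with
    | zero =>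
      rw [zero_add, ← ZMod.sum_eq_sum_range (fun k => χ k), χ.sum_eq_zero_of_ne_one hχ]; simp
    | succ M ih => rw [Nat.succ_add, Finset.sum_range_succ, ih, Finset.sum_range_succ]; simp
  have hmod : ∀ M : ℕ, ‖∑ n ∈ Finset.range M, χ n‖ ≤ q := by
    intro M
    induction M using Nat.strong_induction_on with
    | _ M ih =>
      rcases lt_or_ge M q with h | h
      · refine (norm_sum_le _ _).trans ((Finset.sum_le_card_nsmul _ _ 1 fun n _ => χ.norm_le_one _).trans ?_)
        simpa using h.le
      · obtain ⟨k, rfl⟩ := Nat.exists_eq_add_of_le' h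
        rw [hper]
        exact ih k (by omega)
  have : ∑ n ∈ Finset.Icc 1 N, χ n = ∑ n ∈ Finset.range (N + 1), χ n := by
    rw [Finset.range_eq_Ico, Finset.sum_eq_sum_Ico_succ_bot (Nat.succ_pos N), hχ0, zero_add]
    rfl
  rw [this]
  exact hmod _

end DirichletCharacter

/-! ### Estermann's argument: a real zero forces a lower bound for the residue. -/

open scoped ComplexOrder in
open Complex in
/-- Estermann's lower bound for the residue of a Dirichlet series with nonnegative coefficients whose
continuation vanishes at a real point `β < 1`. Here `h s = (s - 1) * LSeries a s`. -/
theorem one_sub_div_two_le_of_apply_eq_zero {a : ℕ → ℂ} (ha : 0 ≤ a) (ha1 : 1 ≤ a 1)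
    (hsum : ∀ s : ℂ, 1 < s.re → LSeriesSummable a s) {h : ℂ → ℂ} (hd : Differentiable ℂ h)
    (heq : ∀ s : ℂ, 1 < s.re → h s = (s - 1) * LSeries a s) {β : ℝ} (hβ : 5 / 6 ≤ β) (hβ1 : β < 1)
    (h0 : h β = 0) {M : ℝ} (hM : ∀ s ∈ Metric.sphere (2 : ℂ) (4 / 3), ‖dslope h 1 s‖ ≤ M)
    (N : ℕ) (hN : 8 * M * (7 / 8) ^ N ≤ 1 / 2) :
    (1 - β) / 2 ≤ ‖h 1‖ * (2 - β) ^ N := by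
  set G := dslope h 1 with hG
  set ρ : ℝ := 2 - β with hρ
  have hGd : Differentiable ℂ G := by
    rw [← differentiableOn_univ, hG, differentiableOn_dslope Filter.univ_mem]
    exact hd.differentiableOn
  have habs : LSeries.abscissaOfAbsConv a < ((2 : ℝ) : EReal) := by
    refine (LSeries.abscissaOfAbsConv_le_of_forall_lt_LSeriesSummable (x := 1) fun y hy =>
      hsum y (by simpa using hy)).trans_lt ?_
    exact_mod_cast (by norm_num : (1 : ℝ) < 2)
  -- `G` is the Dirichlet series with its pole at 1 subtracted, hence entire; its Taylor series at 2
  -- can be evaluated at β.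
  have hGeq : G =ᶠ[nhds 2] fun s => LSeries a s - h 1 * (s - 1)⁻¹ := by
    have : {z : ℂ | 1 < z.re} ∈ nhds (2 : ℂ) :=
      (isOpen_lt continuous_const Complex.continuous_re).mem_nhds (by simp)
    filter_upwards [this] with s hs
    have hs1 : s ≠ 1 := by rintro rfl; simp at hs
    have hs1' : s - 1 ≠ 0 := sub_ne_zero.2 hs1
    rw [hG, dslope_of_ne _ hs1, slope_def_field, heq s hs]
    field_simp
  have hder (n : ℕ) : iteratedDeriv n G 2 =
      iteratedDeriv n (LSeries a) 2 - h 1 * ((-1) ^ n * n.factorial) := by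
    rw [hGeq.iteratedDeriv_eq, iteratedDeriv_fun_sub, iteratedDeriv_const_mul_field,
      iteratedDeriv_comp_sub_const (f := fun x : ℂ => x⁻¹)]
    · beta_reduce
      rw [iteratedDeriv_eq_iterate (f := fun x : ℂ => x⁻¹), iter_deriv_inv']
      norm_num
    · have := LSeries_analyticOnNhd a 2 (by simpa using habs)
      exact this.contDiffAt
    · refine contDiffAt_const.mul (ContDiffAt.inv (contDiffAt_id.sub contDiffAt_const) ?_)
      norm_num
  -- These are the coefficients of the Dirichlet series in powers of 2 - s, nonnegative because its
  -- derivatives alternate in sign.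
  let c : ℕ → ℂ := fun n => (n.factorial : ℂ)⁻¹ * ((-1) ^ n * iteratedDeriv n (LSeries a) 2)
  have hc (n : ℕ) : 0 ≤ c n := by
    have h1 := LSeries.iteratedDeriv_alternating ha habs n
    rw [ofReal_ofNat] at h1
    refine mul_nonneg ?_ h1
    rw [← ofReal_natCast, ← ofReal_inv, zero_le_real]
    positivity
  have hc0 : 1 ≤ c 0 := by
    simp only [c, Nat.factorial_zero, Nat.cast_one, inv_one, pow_zero, one_mul, iteratedDeriv_zero]
    have h2 : Summable (LSeries.term a 2) := hsum 2 (by simp)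
    have h3 : LSeries.term a 2 1 ≤ LSeries a 2 := by
      have := h2.le_tsum 1 fun j _ => ?_
      · exact this
      · have := LSeries.term_nonneg (ha j) 2
        simpa using this
    refine le_trans ?_ h3
    rw [LSeries.term_of_ne_zero one_ne_zero]
    simpa using ha1
  have hterm (n : ℕ) : (n.factorial : ℂ)⁻¹ • ((β : ℂ) - 2) ^ n • iteratedDeriv n G 2 =
      (c n - h 1) * (ρ : ℂ) ^ n := by
    have hf : (n.factorial : ℂ) ≠ 0 := by exact_mod_cast n.factorial_ne_zero
    have h4 : ((β : ℂ) - 2) ^ n = (-1) ^ n * (ρ : ℂ) ^ n := by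
      rw [← mul_pow, hρ]; congr 1; push_cast; ring
    have h5 : ((-1 : ℂ) ^ n) * (-1) ^ n = 1 := by rw [← mul_pow]; norm_num
    simp only [c, smul_eq_mul]
    rw [hder, h4]
    field_simp
    linear_combination (-(ρ : ℂ) ^ n * h 1 * n.factorial) * h5
  have hβball : (β : ℂ) ∈ Metric.ball (2 : ℂ) (4 / 3) := by
    rw [mem_ball_iff_norm, show (β : ℂ) - 2 = ((β - 2 : ℝ) : ℂ) by push_cast; ring, norm_real,
      Real.norm_eq_abs, abs_of_neg (by linarith)]
    linarith
  have hsumG := hasSum_taylorSeries_on_ball (f := G) hGd.differentiableOn hβball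
  simp only [hterm] at hsumG
  -- Cauchy's estimate on radius 4/3 against |β - 2| ≤ 7/6 gives the ratio 7/8.
  have hbound (n : ℕ) : ‖(c n - h 1) * (ρ : ℂ) ^ n‖ ≤ M * (7 / 8) ^ n := by
    rw [← hterm, norm_smul, norm_smul, norm_inv, Complex.norm_natCast, norm_pow]
    have h6 := norm_iteratedDeriv_le_of_forall_mem_sphere_norm_le n (by norm_num : (0 : ℝ) < 4 / 3)
      hGd.diffContOnCl hM
    have hM0 : 0 ≤ M := (norm_nonneg _).trans (hM (2 + 4 / 3) (by simp))
    have h7 : ‖(β : ℂ) - 2‖ ≤ 7 / 6 := by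
      rw [show (β : ℂ) - 2 = ((β - 2 : ℝ) : ℂ) by push_cast; ring, norm_real,
        Real.norm_eq_abs, abs_of_neg (by linarith)]
      linarith
    have hf : (0 : ℝ) < n.factorial := by positivity
    calc _ ≤ (n.factorial : ℝ)⁻¹ * ((7 / 6) ^ n * (n.factorial * M / (4 / 3) ^ n)) := by gcongr
      _ = M * ((7 / 6) ^ n / (4 / 3) ^ n) := by field_simp
      _ = M * (7 / 8) ^ n := by rw [← div_pow]; norm_num
  have hgeo : HasSum (fun n : ℕ => M * (7 / 8 : ℝ) ^ (n + N)) (8 * M * (7 / 8) ^ N) := by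
    have := (hasSum_geometric_of_lt_one (by norm_num : (0 : ℝ) ≤ 7 / 8) (by norm_num)).mul_left
      (M * (7 / 8) ^ N)
    have h17 : (fun n : ℕ => M * (7 / 8 : ℝ) ^ (n + N)) =
        fun n : ℕ => M * (7 / 8 : ℝ) ^ N * (7 / 8) ^ n := by ext n; rw [pow_add]; ring
    rw [h17, show 8 * M * (7 / 8 : ℝ) ^ N = M * (7 / 8) ^ N * (1 - 7 / 8)⁻¹ by norm_num; ring]
    exact this
  have htail : HasSum (fun n => (c (n + N) - h 1) * (ρ : ℂ) ^ (n + N))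
      (G β - ∑ n ∈ Finset.range N, (c n - h 1) * (ρ : ℂ) ^ n) :=
    (hasSum_nat_add_iff' N).2 hsumG
  have htail' : ‖G β - ∑ n ∈ Finset.range N, (c n - h 1) * (ρ : ℂ) ^ n‖ ≤ 1 / 2 := by
    refine le_trans ?_ hN
    rw [← htail.tsum_eq]
    exact tsum_of_norm_bounded hgeo fun n => hbound (n + N)
  have hβne : (β : ℂ) ≠ 1 := by exact_mod_cast hβ1.ne
  have hGβ : G β = h 1 / ((1 - β : ℝ) : ℂ) := by
    have h8 : (β : ℂ) - 1 ≠ 0 := sub_ne_zero.2 hβne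
    have h9 : (1 : ℂ) - β ≠ 0 := sub_ne_zero.2 hβne.symm
    rw [hG, dslope_of_ne _ hβne, slope_def_field, h0]
    push_cast
    rw [div_eq_div_iff h8 h9]
    ring
  have hgeom : ∑ n ∈ Finset.range N, (ρ : ℂ) ^ n = ((ρ : ℂ) ^ N - 1) / ((1 - β : ℝ) : ℂ) := by
    have : (ρ : ℂ) ≠ 1 := by
      intro h; have : ρ = 1 := by exact_mod_cast h
      linarith
    rw [geom_sum_eq this]
    congr 1
    rw [hρ]; push_cast; ring
  have h1β : ((1 - β : ℝ) : ℂ) ≠ 0 := by exact_mod_cast (by linarith : (1 - β : ℝ) ≠ 0)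
  -- As h(β) = 0, the value of `G` at β is h(1)/(1-β), which absorbs the -1 of the geometric sum.
  -- Nonnegativity of `c` and c₀ ≥ 1 then force h(1) ρ^N/(1-β) to be at least 1/2.
  have hcomb : G β - ∑ n ∈ Finset.range N, (c n - h 1) * (ρ : ℂ) ^ n =
      h 1 * (ρ : ℂ) ^ N / ((1 - β : ℝ) : ℂ) - ∑ n ∈ Finset.range N, c n * (ρ : ℂ) ^ n := by
    simp only [sub_mul]
    rw [Finset.sum_sub_distrib, ← Finset.mul_sum, hgeom, hGβ]
    field_simp
    ring
  have hNpos : N ≠ 0 := by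
    rintro rfl
    have := hM (2 + 4 / 3) (by simp)
    have h10 := hbound 0
    rw [hcomb] at htail'
    simp only [pow_zero, mul_one, Finset.range_zero, Finset.sum_empty, sub_zero] at htail' h10 hN
    have h11 : ‖c 0 - h 1‖ ≤ 1 / 16 := by linarith
    have h12 : ‖h 1‖ ≤ 1 / 2 := by
      rw [norm_div, norm_real, Real.norm_of_nonneg (by linarith), div_le_iff₀ (by linarith)] at htail'
      linarith
    have h13 : (1 : ℝ) ≤ ‖c 0‖ := by
      have := (Complex.le_def.1 hc0).1
      exact this.trans (re_le_norm _)
    have := norm_sub_norm_le (c 0) (h 1)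
    linarith
  have hcsum : 1 ≤ (∑ n ∈ Finset.range N, c n * (ρ : ℂ) ^ n).re := by
    have h14 : c 0 * (ρ : ℂ) ^ 0 ≤ ∑ n ∈ Finset.range N, c n * (ρ : ℂ) ^ n := by
      refine Finset.single_le_sum (f := fun n => c n * (ρ : ℂ) ^ n) (fun n _ => ?_)
        (Finset.mem_range.2 (Nat.pos_of_ne_zero hNpos))
      refine mul_nonneg (hc n) (pow_nonneg ?_ n)
      exact_mod_cast (by linarith : (0 : ℝ) ≤ ρ)
    rw [pow_zero, mul_one] at h14
    exact (Complex.le_def.1 (hc0.trans h14)).1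
  have hfin : 1 / 2 ≤ ‖h 1 * (ρ : ℂ) ^ N / ((1 - β : ℝ) : ℂ)‖ := by
    rw [hcomb] at htail'
    have h15 := re_le_norm (∑ n ∈ Finset.range N, c n * (ρ : ℂ) ^ n)
    have h16 := norm_sub_norm_le (∑ n ∈ Finset.range N, c n * (ρ : ℂ) ^ n)
      (h 1 * (ρ : ℂ) ^ N / ((1 - β : ℝ) : ℂ))
    rw [norm_sub_rev] at h16
    linarith
  rw [norm_div, norm_mul, norm_pow, norm_real, norm_real, Real.norm_of_nonneg (by linarith),
    Real.norm_of_nonneg (by linarith), le_div_iff₀ (by linarith)] at hfin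
  linarith

/-! ### Nonnegativity of the coefficients of ζ(s) L(s, χ₁) L(s, χ₂) L(s, χ₁χ₂). -/

namespace DirichletCharacter

open ArithmeticFunction in
/-- The coefficients of `ζ(s) L(s, χ₁) L(s, χ₂) L(s, χ₁χ₂)`. -/
noncomputable def biquadraticCoeff {q₁ q₂ r : ℕ} (χ₁ : DirichletCharacter ℂ q₁)
    (χ₂ : DirichletCharacter ℂ q₂) (ψ : DirichletCharacter ℂ r) : ArithmeticFunction ℂ :=
  χ₁.zetaMul * (toArithmeticFunction (χ₂ ·) * toArithmeticFunction (ψ ·))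

variable {q₁ q₂ r : ℕ} {χ₁ : DirichletCharacter ℂ q₁} {χ₂ : DirichletCharacter ℂ q₂}
  {ψ : DirichletCharacter ℂ r}

/-- Complete multiplicativity pulls χ₂ out, so with r₁ = 1 * χ₁ the four-fold convolution is r₁ *
(χ₂ r₁). -/
theorem toArithmeticFunction_mul_apply_of_eq_mul (hψ : ∀ n : ℕ, ψ n = χ₁ n * χ₂ n) {n : ℕ} (hn : n ≠ 0) :
    (toArithmeticFunction (χ₂ ·) * toArithmeticFunction (ψ ·)) n = χ₂ n * χ₁.zetaMul n := by
  rw [zetaMul, ArithmeticFunction.mul_apply, ArithmeticFunction.mul_apply, Finset.mul_sum]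
  refine Finset.sum_congr rfl fun x hx => ?_
  have hx' := Nat.mem_divisorsAntidiagonal.1 hx
  have h1 : x.1 ≠ 0 := by rintro h; rw [h, zero_mul] at hx'; exact hn hx'.1.symm
  have h2 : x.2 ≠ 0 := by rintro h; rw [h, mul_zero] at hx'; exact hn hx'.1.symm
  simp only [toArithmeticFunction, ArithmeticFunction.coe_mk, h1, h2, if_false,
    ArithmeticFunction.natCoe_apply, ArithmeticFunction.zeta_apply, Nat.cast_one, one_mul, hψ]
  rw [← hx'.1, Nat.cast_mul, map_mul]
  ring

theorem biquadraticCoeff_comm :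
    biquadraticCoeff χ₁ χ₂ ψ = biquadraticCoeff χ₂ χ₁ ψ := by
  simp only [biquadraticCoeff, zetaMul]
  ring

open scoped ComplexOrder

theorem biquadraticCoeff_prime_pow_nonneg_of_forall (hψ : ∀ n : ℕ, ψ n = χ₁ n * χ₂ n)
    (h₁ : χ₁ ^ 2 = 1) {p : ℕ} (hp : p.Prime)
    (h : ∀ j : ℕ, 0 ≤ χ₂ p ^ j * χ₁.zetaMul (p ^ j)) (k : ℕ) :
    0 ≤ biquadraticCoeff χ₁ χ₂ ψ (p ^ k) := by
  rw [biquadraticCoeff, ArithmeticFunction.mul_apply]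
  refine Finset.sum_nonneg fun x hx => ?_
  have hx' := Nat.mem_divisorsAntidiagonal.1 hx
  obtain ⟨j, _, hj⟩ := (Nat.dvd_prime_pow hp).1 (Dvd.intro_left _ hx'.1)
  refine mul_nonneg (zetaMul_nonneg h₁ _) ?_
  rw [toArithmeticFunction_mul_apply_of_eq_mul hψ (by rw [hj]; exact pow_ne_zero _ hp.ne_zero), hj,
    Nat.cast_pow, map_pow]
  exact h j

theorem zetaMul_prime_pow_of_apply_eq_neg_one {p : ℕ} (hp : p.Prime) (h : χ₁ p = -1) (j : ℕ) :
    χ₁.zetaMul (p ^ j) = if _root_.Even j then 1 else 0 := by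
  rw [zetaMul, ArithmeticFunction.coe_zeta_mul_apply, Nat.sum_divisors_prime_pow hp]
  have : ∀ i, toArithmeticFunction (χ₁ ·) (p ^ i) = (-1 : ℂ) ^ i := fun i => by
    rw [← apply_eq_toArithmeticFunction_apply χ₁ (pow_ne_zero _ hp.ne_zero), Nat.cast_pow, map_pow, h]
  simp only [this, neg_one_geom_sum, Nat.even_add_one]
  by_cases hj : _root_.Even j <;> simp [hj]

/-- By multiplicativity only prime powers matter. If χ₂(p) ≥ 0 the form r₁ * (χ₂ r₁) is visibly
nonnegative; if χ₁(p) ≥ 0 the roles are exchanged. If both values are -1, r₁ vanishes at odd powers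
of p and the sign (-1)^j is harmless. -/
theorem biquadraticCoeff_nonneg (hψ : ∀ n : ℕ, ψ n = χ₁ n * χ₂ n) (h₁ : χ₁ ^ 2 = 1)
    (h₂ : χ₂ ^ 2 = 1) (n : ℕ) : 0 ≤ biquadraticCoeff χ₁ χ₂ ψ n := by
  rcases eq_or_ne n 0 with rfl | hn
  · simp
  have hmul : (biquadraticCoeff χ₁ χ₂ ψ).IsMultiplicative :=
    χ₁.isMultiplicative_zetaMul.mul
      ((isMultiplicative_toArithmeticFunction χ₂).mul (isMultiplicative_toArithmeticFunction ψ))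
  rw [hmul.multiplicative_factorization _ hn]
  refine Finset.prod_nonneg fun p hp => ?_
  have hp := Nat.prime_of_mem_primeFactors hp
  have hsimple {a b : ℕ} (χ : DirichletCharacter ℂ a) (χ' : DirichletCharacter ℂ b) (hχ : χ ^ 2 = 1)
      (h : 0 ≤ χ' p) (j : ℕ) : 0 ≤ χ' p ^ j * χ.zetaMul (p ^ j) :=
    mul_nonneg (pow_nonneg h j) (zetaMul_nonneg hχ _)
  rcases MulChar.isQuadratic_iff_sq_eq_one.mpr h₂ p with h | h | h
  · exact biquadraticCoeff_prime_pow_nonneg_of_forall hψ h₁ hp (hsimple _ _ h₁ h.ge) _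
  · exact biquadraticCoeff_prime_pow_nonneg_of_forall hψ h₁ hp
      (hsimple _ _ h₁ (by rw [h]; exact zero_le_one)) _
  · have hψ' : ∀ n : ℕ, ψ n = χ₂ n * χ₁ n := fun n => by rw [hψ, mul_comm]
    rcases MulChar.isQuadratic_iff_sq_eq_one.mpr h₁ p with h' | h' | h'
    · rw [biquadraticCoeff_comm]
      exact biquadraticCoeff_prime_pow_nonneg_of_forall hψ' h₂ hp (hsimple _ _ h₂ h'.ge) _
    · rw [biquadraticCoeff_comm]
      exact biquadraticCoeff_prime_pow_nonneg_of_forall hψ' h₂ hp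
        (hsimple _ _ h₂ (by rw [h']; exact zero_le_one)) _
    · refine biquadraticCoeff_prime_pow_nonneg_of_forall hψ h₁ hp (fun j => ?_) _
      rw [h, zetaMul_prime_pow_of_apply_eq_neg_one hp h']
      split_ifs with hj
      · rw [hj.neg_one_pow, one_mul]; exact zero_le_one
      · simp

theorem biquadraticCoeff_one : biquadraticCoeff χ₁ χ₂ ψ 1 = 1 := by
  have hmul : (biquadraticCoeff χ₁ χ₂ ψ).IsMultiplicative :=
    χ₁.isMultiplicative_zetaMul.mul
      ((isMultiplicative_toArithmeticFunction χ₂).mul (isMultiplicative_toArithmeticFunction ψ))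
  exact hmul.map_one

theorem LSeriesSummable_toArithmeticFunction {N : ℕ} (χ : DirichletCharacter ℂ N) {s : ℂ}
    (hs : 1 < s.re) : LSeriesSummable (toArithmeticFunction (χ ·)) s := by
  refine LSeriesSummable_of_bounded_of_one_lt_re (m := 1) (fun n hn => ?_) hs
  rw [← apply_eq_toArithmeticFunction_apply χ hn]
  exact χ.norm_le_one _

theorem LSeriesSummable_biquadraticCoeff {s : ℂ} (hs : 1 < s.re) :
    LSeriesSummable (biquadraticCoeff χ₁ χ₂ ψ) s :=
  ArithmeticFunction.LSeriesSummable_mul (χ₁.LSeriesSummable_zetaMul hs)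
    (ArithmeticFunction.LSeriesSummable_mul (LSeriesSummable_toArithmeticFunction χ₂ hs)
      (LSeriesSummable_toArithmeticFunction ψ hs))

theorem LSeries_toArithmeticFunction_eq_LFunction {N : ℕ} [NeZero N] (χ : DirichletCharacter ℂ N) {s : ℂ}
    (hs : 1 < s.re) : LSeries (toArithmeticFunction (χ ·)) s = χ.LFunction s := by
  rw [LFunction_eq_LSeries χ hs]
  exact LSeries_congr (fun {n} hn => (apply_eq_toArithmeticFunction_apply χ hn).symm) s

theorem LSeries_biquadraticCoeff [NeZero q₁] [NeZero q₂] [NeZero r] {s : ℂ} (hs : 1 < s.re) :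
    LSeries (biquadraticCoeff χ₁ χ₂ ψ) s =
      riemannZeta s * χ₁.LFunction s * (χ₂.LFunction s * ψ.LFunction s) := by
  have h23 := ArithmeticFunction.LSeriesSummable_mul (LSeriesSummable_toArithmeticFunction χ₂ hs)
    (LSeriesSummable_toArithmeticFunction ψ hs)
  have e1 : LSeries (biquadraticCoeff χ₁ χ₂ ψ) s = LSeries χ₁.zetaMul s *
      LSeries (toArithmeticFunction (χ₂ ·) * toArithmeticFunction (ψ ·) : ArithmeticFunction ℂ) s :=
    ArithmeticFunction.LSeries_mul' (χ₁.LSeriesSummable_zetaMul hs) h23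
  have e2 : LSeries χ₁.zetaMul s = LSeries (ArithmeticFunction.zeta : ArithmeticFunction ℂ) s *
      LSeries (toArithmeticFunction (χ₁ ·)) s :=
    ArithmeticFunction.LSeries_mul' (ArithmeticFunction.LSeriesSummable_zeta_iff.mpr hs)
      (LSeriesSummable_toArithmeticFunction χ₁ hs)
  have e3 : LSeries (toArithmeticFunction (χ₂ ·) * toArithmeticFunction (ψ ·) : ArithmeticFunction ℂ) s =
      LSeries (toArithmeticFunction (χ₂ ·)) s * LSeries (toArithmeticFunction (ψ ·)) s :=
    ArithmeticFunction.LSeries_mul' (LSeriesSummable_toArithmeticFunction χ₂ hs)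
      (LSeriesSummable_toArithmeticFunction ψ hs)
  have e4 : LSeries (ArithmeticFunction.zeta : ArithmeticFunction ℂ) s = riemannZeta s :=
    ArithmeticFunction.LSeries_zeta_eq_riemannZeta hs
  rw [e1, e2, e3, e4, LSeries_toArithmeticFunction_eq_LFunction χ₁ hs,
    LSeries_toArithmeticFunction_eq_LFunction χ₂ hs, LSeries_toArithmeticFunction_eq_LFunction ψ hs]

end DirichletCharacter

/-! ### Real coefficients of quadratic characters, and Estermann's bound for a pair of them. -/

namespace DirichletCharacter

section reCoeff

variable {q : ℕ}

/-- The real parts of the values of a Dirichlet character, as an arithmetic function. -/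
noncomputable def reCoeff (χ : DirichletCharacter ℂ q) : ArithmeticFunction ℝ :=
  ⟨fun n => if n = 0 then 0 else (χ n).re, by simp⟩

theorem reCoeff_apply (χ : DirichletCharacter ℂ q) {n : ℕ} (hn : n ≠ 0) : χ.reCoeff n = (χ n).re := by
  simp [reCoeff, hn]

theorem abs_reCoeff_le_one (χ : DirichletCharacter ℂ q) (n : ℕ) : |χ.reCoeff n| ≤ 1 := by
  rcases eq_or_ne n 0 with rfl | hn
  · simp
  · rw [reCoeff_apply χ hn]
    exact (Complex.abs_re_le_norm _).trans (χ.norm_le_one _)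

theorem reCoeff_mul_zeta_apply (χ : DirichletCharacter ℂ q) (n : ℕ) :
    (χ.reCoeff * (ArithmeticFunction.zeta : ArithmeticFunction ℝ)) n = (χ.zetaMul n).re := by
  rw [ArithmeticFunction.coe_mul_zeta_apply, zetaMul, ArithmeticFunction.coe_zeta_mul_apply,
    Complex.re_sum]
  refine Finset.sum_congr rfl fun d hd => ?_
  have hd0 : d ≠ 0 := (Nat.pos_of_mem_divisors hd).ne'
  rw [reCoeff_apply χ hd0, ← apply_eq_toArithmeticFunction_apply χ hd0]

theorem reCoeff_mul_zeta_nonneg {χ : DirichletCharacter ℂ q} (hχ : χ ^ 2 = 1) (n : ℕ) :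
    0 ≤ (χ.reCoeff * (ArithmeticFunction.zeta : ArithmeticFunction ℝ)) n := by
  rw [reCoeff_mul_zeta_apply]
  exact (Complex.le_def.1 (zetaMul_nonneg hχ n)).1

theorem im_apply_eq_zero {χ : DirichletCharacter ℂ q} (hχ : χ.IsQuadratic) (a : ZMod q) :
    (χ a).im = 0 := by
  rcases hχ a with h | h | h <;> simp [h]

variable [NeZero q]

theorem abs_sum_reCoeff_sub_le {χ : DirichletCharacter ℂ q} (hχ : χ ≠ 1)
    {B : ℝ} (hB : ∀ N : ℕ, ‖∑ k ∈ Finset.Icc 1 N, χ k‖ ≤ B) {s : ℝ} (hs : 0 < s) {N : ℕ} (hN : 1 ≤ N) :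
    |∑ k ∈ Finset.Ioc 0 N, χ.reCoeff k * (k : ℝ) ^ (-s) - (χ.LFunction s).re| ≤
      2 * B * (N : ℝ) ^ (-s) := by
  have h := norm_sum_mul_cpow_sub_LFunction_le hχ hB hs hN
  refine le_trans (le_of_eq ?_) ((Complex.abs_re_le_norm _).trans h)
  rw [Complex.sub_re, Complex.re_sum]
  congr 2
  refine Finset.sum_congr rfl fun k hk => ?_
  rw [reCoeff_apply χ (Finset.mem_Ioc.1 hk).1.ne', ← Complex.ofReal_natCast, ← Complex.ofReal_neg,
    ← Complex.ofReal_cpow (by positivity), Complex.re_mul_ofReal]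

theorem LFunction_im_eq_zero {χ : DirichletCharacter ℂ q} (hχ : χ ≠ 1) (hχ2 : χ.IsQuadratic)
    {s : ℝ} (hs : 0 < s) : (χ.LFunction s).im = 0 := by
  have hbound : ∀ᶠ N : ℕ in Filter.atTop, |(χ.LFunction s).im| ≤ 2 * q * (N : ℝ) ^ (-s) := by
    filter_upwards [Filter.eventually_ge_atTop 1] with N hN
    have h := norm_sum_mul_cpow_sub_LFunction_le hχ (norm_sum_Icc_le_modulus hχ) hs hN
    refine le_trans (le_of_eq ?_) ((Complex.abs_im_le_norm _).trans h)
    rw [Complex.sub_im, Complex.im_sum, Finset.sum_eq_zero, zero_sub, abs_neg]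
    intro k _
    rw [← Complex.ofReal_natCast, ← Complex.ofReal_neg,
      ← Complex.ofReal_cpow (by positivity), Complex.im_mul_ofReal, im_apply_eq_zero hχ2, zero_mul]
  have hlim : Filter.Tendsto (fun N : ℕ => 2 * q * (N : ℝ) ^ (-s)) Filter.atTop (nhds (2 * q * 0)) :=
    ((tendsto_rpow_neg_atTop hs).comp tendsto_natCast_atTop_atTop).const_mul _
  rw [mul_zero] at hlim
  exact abs_nonpos_iff.1 (ge_of_tendsto hlim hbound)

theorem abs_re_LFunction_eq_norm {χ : DirichletCharacter ℂ q} (hχ : χ ≠ 1) (hχ2 : χ.IsQuadratic)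
    {s : ℝ} (hs : 0 < s) : |(χ.LFunction s).re| = ‖χ.LFunction s‖ :=
  (Complex.abs_re_eq_norm.2 (LFunction_im_eq_zero hχ hχ2 hs))

/-- Truncation at N = q with the trivial bound q for character sums leaves an error of 2. -/
theorem norm_LFunction_one_le {χ : DirichletCharacter ℂ q} (hχ : χ ≠ 1) :
    ‖χ.LFunction 1‖ ≤ 3 + Real.log q := by
  have hq : 1 ≤ q := Nat.pos_of_neZero q
  have hq0 : (0 : ℝ) < q := by exact_mod_cast hq
  have h := norm_sum_mul_cpow_sub_LFunction_le hχ (norm_sum_Icc_le_modulus hχ) one_pos hq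
  rw [Complex.ofReal_one, Real.rpow_neg_one, mul_inv_cancel_right₀ hq0.ne'] at h
  have h2 : ‖∑ k ∈ Finset.Ioc 0 q, χ k * (k : ℂ) ^ (-1 : ℂ)‖ ≤ 1 + Real.log q := by
    refine (norm_sum_le _ _).trans (le_trans (Finset.sum_le_sum fun k hk => ?_) (sum_rpow_neg_one_le q))
    rw [norm_mul, Complex.norm_natCast_cpow_of_pos (Finset.mem_Ioc.1 hk).1]
    exact mul_le_of_le_one_left (by positivity) (χ.norm_le_one _)
  have h3 := norm_sub_norm_le (χ.LFunction 1) (∑ k ∈ Finset.Ioc 0 q, χ k * (k : ℂ) ^ (-1 : ℂ))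
  rw [norm_sub_rev] at h3
  linarith

end reCoeff

theorem exists_norm_LFunctionTrivChar₁_le :
    ∃ C : ℝ, 1 ≤ C ∧ ∀ s ∈ Metric.closedBall (2 : ℂ) (4 / 3), ‖LFunctionTrivChar₁ 1 s‖ ≤ C := by
  obtain ⟨C, hC⟩ := (isCompact_closedBall (2 : ℂ) (4 / 3)).exists_bound_of_continuousOn
    (differentiable_LFunctionTrivChar₁ 1).continuous.continuousOn
  exact ⟨max 1 C, le_max_left _ _, fun s hs => (hC s hs).trans (le_max_right _ _)⟩

open scoped ComplexOrder in
theorem exists_one_sub_div_two_le_norm_mul :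
    ∃ C : ℝ, 1 ≤ C ∧ ∀ (q₁ q₂ : ℕ) [NeZero q₁] [NeZero q₂] (χ₁ : DirichletCharacter ℂ q₁)
      (χ₂ : DirichletCharacter ℂ q₂) (ψ : DirichletCharacter ℂ (q₁ * q₂)), χ₁ ≠ 1 → χ₂ ≠ 1 → ψ ≠ 1 →
      χ₁ ^ 2 = 1 → χ₂ ^ 2 = 1 → (∀ n : ℕ, ψ n = χ₁ n * χ₂ n) → ∀ β : ℝ, 5 / 6 ≤ β → β < 1 →
      χ₁.LFunction β = 0 → ∀ N : ℕ, 8 * (C * ((q₁ : ℝ) * q₂) ^ 2) * (7 / 8) ^ N ≤ 1 / 2 →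
      (1 - β) / 2 ≤ ‖χ₁.LFunction 1‖ * ‖χ₂.LFunction 1‖ * ‖ψ.LFunction 1‖ * (2 - β) ^ N := by
  obtain ⟨C, hC1, hC⟩ := exists_norm_LFunctionTrivChar₁_le
  -- Each L-function is at most 5 times its modulus on the disc, giving 125 for the product. The
  -- slope at 1 adds two values of `h` and divides by a distance at least 1/3, giving 6 · 125 = 750.
  refine ⟨750 * C, by linarith, fun q₁ q₂ _ _ χ₁ χ₂ ψ h1 h2 h3 hs1 hs2 hψ β hβ hβ1 hL N hN => ?_⟩
  let P : ℂ → ℂ := fun s => χ₁.LFunction s * (χ₂.LFunction s * ψ.LFunction s)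
  let h : ℂ → ℂ := fun s => LFunctionTrivChar₁ 1 s * P s
  have hPd : Differentiable ℂ P := (differentiable_LFunction h1).mul
    ((differentiable_LFunction h2).mul (differentiable_LFunction h3))
  have hd : Differentiable ℂ h := (differentiable_LFunctionTrivChar₁ 1).mul hPd
  have hP (s : ℂ) (hs : s ∈ Metric.closedBall (2 : ℂ) (4 / 3)) :
      ‖P s‖ ≤ 125 * ((q₁ : ℝ) * q₂) ^ 2 := by
    rw [mem_closedBall_iff_norm] at hs
    have hre : 2 / 3 ≤ s.re := by
      have := (Complex.abs_re_le_norm (s - 2)).trans hs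
      rw [abs_le] at this
      simp only [Complex.sub_re, Complex.re_ofNat] at this
      linarith [this.1]
    have hn : ‖s‖ ≤ 10 / 3 := by
      have := norm_sub_norm_le s 2
      simp only [Complex.norm_ofNat] at this
      linarith
    have key {q : ℕ} [NeZero q] {χ : DirichletCharacter ℂ q} (hχ : χ ≠ 1) : ‖χ.LFunction s‖ ≤ 5 * q := by
      refine (norm_LFunction_le_of_sum_le hχ (norm_sum_Icc_le_modulus hχ) (by linarith)).trans ?_
      calc ‖s‖ * (q / s.re) ≤ 10 / 3 * (q / (2 / 3)) := by gcongr
        _ = 5 * q := by ring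
    calc ‖P s‖ = ‖χ₁.LFunction s‖ * (‖χ₂.LFunction s‖ * ‖ψ.LFunction s‖) := by simp only [P, norm_mul]
      _ ≤ (5 * q₁) * ((5 * q₂) * (5 * (q₁ * q₂ : ℕ))) := by
        gcongr
        exacts [key h1, key h2, key h3]
      _ = _ := by push_cast; ring
  have hh (s : ℂ) (hs : s ∈ Metric.closedBall (2 : ℂ) (4 / 3)) :
      ‖h s‖ ≤ C * (125 * ((q₁ : ℝ) * q₂) ^ 2) := by
    simp only [h, norm_mul]
    exact mul_le_mul (hC s hs) (hP s hs) (norm_nonneg _) (by linarith)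
  have h11 : h 1 = P 1 := by simp [h]
  have := one_sub_div_two_le_of_apply_eq_zero (a := biquadraticCoeff χ₁ χ₂ ψ)
    (fun n => biquadraticCoeff_nonneg hψ hs1 hs2 n) biquadraticCoeff_one.ge
    (fun s hs => LSeriesSummable_biquadraticCoeff hs) hd ?_ hβ hβ1 ?_ ?_ N hN
  · rw [h11] at this
    simp only [P, norm_mul, ← mul_assoc] at this
    exact this
  · intro s hs
    have hs1 : s ≠ 1 := by rintro rfl; simp at hs
    rw [LSeries_biquadraticCoeff hs]
    simp only [h, P, Function.update_of_ne hs1, LFunctionTrivChar, LFunction_modOne_eq]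
    ring
  · simp [h, P, hL]
  · intro s hs
    have hs1 : s ≠ 1 := by
      rintro rfl
      rw [mem_sphere_iff_norm] at hs
      norm_num at hs
    have hs' := Metric.sphere_subset_closedBall hs
    have h1' : (1 : ℂ) ∈ Metric.closedBall (2 : ℂ) (4 / 3) := by
      rw [mem_closedBall_iff_norm]; norm_num
    have hdist : 1 / 3 ≤ ‖s - 1‖ := by
      rw [mem_sphere_iff_norm] at hs
      have h5 := norm_sub_norm_le (s - 2) (-1)
      rw [norm_neg, norm_one, hs, show s - 2 - -1 = s - 1 by ring] at h5
      linarith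
    rw [dslope_of_ne _ hs1, slope_def_field, norm_div, div_le_iff₀ (by linarith)]
    calc ‖h s - h 1‖ ≤ ‖h s‖ + ‖h 1‖ := norm_sub_le _ _
      _ ≤ C * (125 * ((q₁ : ℝ) * q₂) ^ 2) + C * (125 * ((q₁ : ℝ) * q₂) ^ 2) :=
        add_le_add (hh s hs') (hh 1 h1')
      _ = 750 * C * ((q₁ : ℝ) * q₂) ^ 2 * (1 / 3) := by ring
      _ ≤ _ := by gcongr

end DirichletCharacter

/-! ### Siegel zeros and Siegel's bound for their quality. -/

open DirichletCharacter

namespace IsSiegelZero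

variable {q : ℕ} [NeZero q] {χ : DirichletCharacter ℂ q} {η β : ℝ}

theorem three_le (h : IsSiegelZero χ η β) : 3 ≤ q := by
  by_contra hq
  have h0 := Nat.pos_of_neZero q
  obtain rfl | rfl : q = 1 ∨ q = 2 := by omega
  · exact h.ne_one (level_one χ)
  · refine h.ne_one (MulChar.ext fun u => ?_)
    have : u = 1 := Subsingleton.elim _ _
    simp [this]

theorem one_lt_log (h : IsSiegelZero χ η β) : 1 < Real.log q := by
  rw [Real.lt_log_iff_exp_lt (by have := Nat.pos_of_neZero q; positivity)]
  have := Real.exp_one_lt_three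
  have h3 : (3 : ℝ) ≤ q := by exact_mod_cast h.three_le
  linarith

theorem quality_pos (h : IsSiegelZero χ η β) : 0 < η := by linarith [h.ten_le_quality]

theorem ten_lt (h : IsSiegelZero χ η β) : 10 < η * Real.log q := by
  nlinarith [h.one_lt_log, h.ten_le_quality]

theorem one_sub_eq (h : IsSiegelZero χ η β) : 1 - β = 1 / (η * Real.log q) := by
  rw [h.eq_one_sub]; ring

theorem one_div_one_sub (h : IsSiegelZero χ η β) : 1 / (1 - β) = η * Real.log q := by
  rw [h.one_sub_eq, one_div_one_div]

theorem lt_one (h : IsSiegelZero χ η β) : β < 1 := by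
  have : 0 < 1 / (η * Real.log q) := one_div_pos.2 (by linarith [h.ten_lt])
  rw [h.eq_one_sub]; linarith

theorem nine_tenths_lt (h : IsSiegelZero χ η β) : 9 / 10 < β := by
  have : 1 / (η * Real.log q) < 1 / 10 := one_div_lt_one_div_of_lt (by norm_num) h.ten_lt
  rw [h.eq_one_sub]; linarith

theorem sq_eq_one (h : IsSiegelZero χ η β) : χ ^ 2 = 1 :=
  MulChar.isQuadratic_iff_sq_eq_one.mp h.isQuadratic

/-- A power of the conductor is essentially constant when raised to `1 - β`. -/
theorem rpow_one_sub (h : IsSiegelZero χ η β) (c : ℝ) :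
    ((q : ℝ) ^ c) ^ (1 - β) = Real.exp (c / η) := by
  have hq : (0 : ℝ) < q := by exact_mod_cast Nat.pos_of_neZero q
  have hl : Real.log q ≠ 0 := by linarith [h.one_lt_log]
  have := h.quality_pos.ne'
  rw [← Real.rpow_mul hq.le, Real.rpow_def_of_pos hq, h.one_sub_eq]
  congr 1
  field_simp

end IsSiegelZero

/-- For bounded conductors the quality of Siegel zeros is bounded. -/
theorem exists_quality_mul_log_le_of_le (q₀ : ℕ) : ∃ C : ℝ, 0 < C ∧ ∀ (q : ℕ) [NeZero q]
    (χ : DirichletCharacter ℂ q) (η β : ℝ), IsSiegelZero χ η β → q ≤ q₀ → η * Real.log q ≤ C := by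
  -- Since L(1, χ) ≠ 0, continuity keeps the zeros of a fixed χ away from 1; there are finitely many
  -- χ of bounded modulus.
  have hχ : ∀ (q : ℕ) [NeZero q] (χ : DirichletCharacter ℂ q), ∃ C : ℝ, ∀ η β : ℝ,
      IsSiegelZero χ η β → η * Real.log q ≤ C := by
    intro q _ χ
    by_cases h1 : χ = 1
    · exact ⟨0, fun η β h => absurd h1 h.ne_one⟩
    have hc : ContinuousAt (fun x : ℝ => χ.LFunction (x : ℂ)) 1 :=
      ((differentiable_LFunction h1).continuous.comp Complex.continuous_ofReal).continuousAt
    have hne := hc.eventually_ne (y := 0) (by simpa using LFunction_apply_one_ne_zero h1)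
    obtain ⟨δ, hδ, hball⟩ := Metric.eventually_nhds_iff.1 hne
    refine ⟨1 / δ, fun η β h => ?_⟩
    by_contra hlt
    push Not at hlt
    refine hball (y := β) ?_ h.LFunction_eq_zero
    rw [Real.dist_eq, abs_sub_comm, abs_of_pos (by linarith [h.lt_one]), h.one_sub_eq]
    rw [div_lt_iff₀ (by linarith [h.ten_lt])]
    rw [div_lt_iff₀ hδ] at hlt
    linarith
  have hq : ∀ q : ℕ, ∃ C : ℝ, ∀ [NeZero q] (χ : DirichletCharacter ℂ q) (η β : ℝ),
      IsSiegelZero χ η β → η * Real.log q ≤ C := by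
    intro q
    rcases Nat.eq_zero_or_pos q with rfl | hq0
    · exact ⟨0, fun {h} => absurd rfl h.out⟩
    · have : NeZero q := ⟨hq0.ne'⟩
      choose C hC using hχ q
      obtain ⟨M, hM⟩ := (Set.finite_range C).bddAbove
      exact ⟨M, fun χ η β h => (hC χ η β h).trans (hM ⟨χ, rfl⟩)⟩
  choose C hC using hq
  refine ⟨1 + ∑ q ∈ Finset.range (q₀ + 1), |C q|, by positivity, fun q _ χ η β h hle => ?_⟩
  have h1 := Finset.single_le_sum (f := fun q => |C q|) (fun _ _ => abs_nonneg _)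
    (Finset.mem_range.2 (Nat.lt_succ_of_le hle))
  have h2 := hC q χ η β h
  have h3 := le_abs_self (C q)
  linarith

open Finset ArithmeticFunction in
theorem sum_mul_zeta_le_sq (f : ArithmeticFunction ℝ) (hf : ∀ n, |f n| ≤ 1) {Y : ℕ} (hY : 1 ≤ Y) :
    ∑ n ∈ Ioc 0 Y, (f * (zeta : ArithmeticFunction ℝ)) n * (n : ℝ) ^ (-1 : ℝ) ≤
      (1 + Real.log Y) ^ 2 := by
  have hlog : 0 ≤ Real.log Y := Real.log_nonneg (by exact_mod_cast hY)
  rw [sum_mul_zeta_mul_rpow, sq]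
  calc _ ≤ ∑ d ∈ Ioc 0 Y, (d : ℝ) ^ (-1 : ℝ) * (1 + Real.log Y) := by
        refine sum_le_sum fun d hd => ?_
        obtain ⟨hd0, hdY⟩ := mem_Ioc.1 hd
        have h1 : ∑ m ∈ Ioc 0 (Y / d), (m : ℝ) ^ (-1 : ℝ) ≤ 1 + Real.log Y := by
          refine (sum_rpow_neg_one_le _).trans ?_
          have : 0 < Y / d := Nat.div_pos hdY hd0
          have : Real.log (Y / d : ℕ) ≤ Real.log Y :=
            Real.log_le_log (by exact_mod_cast this) (by exact_mod_cast Nat.div_le_self _ _)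
          linarith
        have h2 : (0 : ℝ) ≤ ∑ m ∈ Ioc 0 (Y / d), (m : ℝ) ^ (-1 : ℝ) := by positivity
        have h3 : (0 : ℝ) ≤ (d : ℝ) ^ (-1 : ℝ) := by positivity
        have h4 : f d * (d : ℝ) ^ (-1 : ℝ) ≤ (d : ℝ) ^ (-1 : ℝ) :=
          mul_le_of_le_one_left h3 ((le_abs_self _).trans (hf d))
        exact mul_le_mul h4 h1 h2 h3
    _ ≤ _ := by
        rw [← sum_mul]
        exact mul_le_mul_of_nonneg_right (sum_rpow_neg_one_le Y) (by linarith)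

/-- A lower bound for `L(1, χ)` gives an upper bound for the quality. -/
theorem IsSiegelZero.quality_mul_log_mul_le {q : ℕ} [NeZero q] {χ : DirichletCharacter ℂ q} {η β : ℝ}
    (h : IsSiegelZero χ η β) (hL : 16 * (q : ℝ) ^ (-4 : ℝ) ≤ ‖χ.LFunction 1‖) :
    η * Real.log q * ‖χ.LFunction 1‖ ≤ 8 * (1 + 6 * Real.log q) ^ 2 := by
  have hq3 : (3 : ℝ) ≤ q := by exact_mod_cast h.three_le
  have hq0 : (0 : ℝ) < q := by linarith
  have hq1 : 1 ≤ q := Nat.pos_of_neZero q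
  have hβ0 : 0 < β := by linarith [h.nine_tenths_lt]
  have hlog := h.one_lt_log
  -- The cutoffs are D = q^5 and Y = q^6, so the trivial character sum bound q suffices, with error
  -- of order q^(-4). The condition η ≥ 10 makes exp(5/η) at most 2.
  have hW : ((q ^ 5 : ℕ) : ℝ) ^ (1 - β) ≤ 2 := by
    have := h.rpow_one_sub 5
    norm_cast at this ⊢
    rw [this]
    have h5 : ((5 : ℕ) : ℝ) / η ≤ 1 / 2 := by
      rw [div_le_div_iff₀ h.quality_pos two_pos]
      push_cast
      linarith [h.ten_le_quality]
    have h6 : Real.exp (1 / 2) ^ 2 = Real.exp 1 := by rw [← Real.exp_nat_mul]; norm_num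
    have h7 := Real.exp_one_lt_three
    have h8 : Real.exp (1 / 2) ≤ 2 := by nlinarith [Real.exp_pos (1 / 2)]
    exact (Real.exp_le_exp.2 h5).trans h8
  have hqpow : (q : ℝ) ^ (-4 : ℝ) = q / (q ^ 5 : ℕ) := by
    rw [Real.rpow_neg hq0.le]
    norm_cast
    push_cast
    field_simp
  have hB := norm_sum_Icc_le_modulus h.ne_one
  have hD1 : 1 ≤ q ^ 5 := Nat.one_le_pow _ _ hq1
  have hDpos : (0 : ℝ) < (q ^ 5 : ℕ) := by exact_mod_cast hD1
  have hT1 : ∀ N, q ^ 5 ≤ N → |∑ d ∈ Finset.Ioc 0 N, χ.reCoeff d * (d : ℝ) ^ (-1 : ℝ) -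
      (χ.LFunction 1).re| ≤ 4 * (q : ℝ) ^ (-4 : ℝ) := by
    intro N hN
    have h1 := abs_sum_reCoeff_sub_le h.ne_one hB one_pos (hD1.trans hN)
    rw [Complex.ofReal_one] at h1
    have h2 : (N : ℝ) ^ (-1 : ℝ) ≤ 1 / (q ^ 5 : ℕ) := by
      rw [Real.rpow_neg_one, ← one_div]
      exact one_div_le_one_div_of_le hDpos (by exact_mod_cast hN)
    have h3 : 2 * q * (N : ℝ) ^ (-1 : ℝ) ≤ 2 * q * (1 / (q ^ 5 : ℕ)) := by gcongr
    have h4 : 2 * q * (1 / (q ^ 5 : ℕ)) = 2 * (q : ℝ) ^ (-4 : ℝ) := by rw [hqpow]; ring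
    have : (0 : ℝ) ≤ (q : ℝ) ^ (-4 : ℝ) := by positivity
    linarith
  have hTβ : ∀ N, q ^ 5 ≤ N → |∑ d ∈ Finset.Ioc 0 N, χ.reCoeff d * (d : ℝ) ^ (-β) - 0| ≤
      4 * (q : ℝ) ^ (-4 : ℝ) := by
    intro N hN
    have h1 := abs_sum_reCoeff_sub_le h.ne_one hB hβ0 (hD1.trans hN)
    rw [h.LFunction_eq_zero, Complex.zero_re] at h1
    have h2 : (N : ℝ) ^ (-β) ≤ ((q ^ 5 : ℕ) : ℝ) ^ (-β) :=
      Real.rpow_le_rpow_of_nonpos hDpos (by exact_mod_cast hN) (by linarith)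
    have h3 : ((q ^ 5 : ℕ) : ℝ) ^ (-β) = ((q ^ 5 : ℕ) : ℝ) ^ (1 - β) / (q ^ 5 : ℕ) := by
      rw [← Real.rpow_sub_one hDpos.ne']; ring_nf
    have h4 : 2 * (q : ℝ) * (N : ℝ) ^ (-β) ≤ 2 * q * (2 / (q ^ 5 : ℕ)) := by
      refine mul_le_mul_of_nonneg_left (h2.trans ?_) (by positivity)
      rw [h3]; gcongr
    have h5 : 2 * q * (2 / (q ^ 5 : ℕ)) = 4 * (q : ℝ) ^ (-4 : ℝ) := by rw [hqpow]; ring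
    linarith
  have hmain := abs_div_one_sub_le χ.reCoeff χ.abs_reCoeff_le_one (reCoeff_mul_zeta_nonneg h.sq_eq_one)
    hβ0 h.lt_one hD1 (Nat.pow_le_pow_right hq1 (by norm_num : 5 ≤ 6)) hT1 hTβ
  have hTriv := sum_mul_zeta_le_sq χ.reCoeff χ.abs_reCoeff_le_one (Nat.one_le_pow 6 q hq1)
  have habs : |(χ.LFunction 1).re| = ‖χ.LFunction 1‖ := by
    have := abs_re_LFunction_eq_norm h.ne_one h.isQuadratic one_pos
    rwa [Complex.ofReal_one] at this
  have hlog6 : Real.log (q ^ 6 : ℕ) = 6 * Real.log q := by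
    push_cast; rw [Real.log_pow]; norm_num
  rw [habs, hlog6, div_eq_mul_one_div, h.one_div_one_sub, div_eq_mul_one_div (2 * _) (1 - β),
    h.one_div_one_sub] at hmain
  rw [hlog6] at hTriv
  have hdiv : 2 * ((q ^ 5 : ℕ) : ℝ) / (q ^ 6 : ℕ) ≤ 1 := by
    push_cast
    rw [div_le_one (by positivity)]
    nlinarith [pow_pos hq0 5]
  have hsmall : (q : ℝ) ^ (-4 : ℝ) ≤ 1 / 8 := by
    rw [Real.rpow_neg hq0.le, ← one_div]
    refine one_div_le_one_div_of_le (by norm_num) ?_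
    norm_cast
    calc 8 ≤ 3 ^ 4 := by norm_num
      _ ≤ q ^ 4 := Nat.pow_le_pow_left h.three_le 4
  have hQ0 : 0 < η * Real.log q := by linarith [h.ten_lt]
  -- The hypothesis `hL` lets the error that carries 1/(1-β) be absorbed into half of the main term.
  have hKQ : 2 * (4 * (q : ℝ) ^ (-4 : ℝ)) * (η * Real.log q) ≤ ‖χ.LFunction 1‖ / 2 * (η * Real.log q) := by
    gcongr; linarith
  have hKl : 2 * (4 * (q : ℝ) ^ (-4 : ℝ)) * (1 + 6 * Real.log q) ≤ 1 * (1 + 6 * Real.log q) := by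
    gcongr; linarith
  nlinarith

/-- If the product were trivial, χ₂² = 1 would make the two lifts equal; their conductors, which are
q₁ and q₂ by primitivity, would then agree. -/
theorem DirichletCharacter.exists_mul_level_ne_one {q₁ q₂ : ℕ} [NeZero q₁] [NeZero q₂]
    {χ₁ : DirichletCharacter ℂ q₁} {χ₂ : DirichletCharacter ℂ q₂} (h₁ : χ₁.IsPrimitive)
    (h₂ : χ₂.IsPrimitive) (hs : χ₂ ^ 2 = 1) (hq : q₁ ≠ q₂) :
    ∃ ψ : DirichletCharacter ℂ (q₁ * q₂), ψ ≠ 1 ∧ ∀ n : ℕ, ψ n = χ₁ n * χ₂ n := by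
  have hd₁ : q₁ ∣ q₁ * q₂ := dvd_mul_right _ _
  have hd₂ : q₂ ∣ q₁ * q₂ := dvd_mul_left _ _
  refine ⟨changeLevel hd₁ χ₁ * changeLevel hd₂ χ₂, fun h => hq ?_, fun n => ?_⟩
  · have hinv : changeLevel hd₂ χ₂ * changeLevel hd₂ χ₂ = 1 := by
      rw [← map_mul, ← sq, hs, map_one]
    have heq : changeLevel hd₁ χ₁ = changeLevel hd₂ χ₂ := by
      rw [eq_inv_of_mul_eq_one_left h, inv_eq_of_mul_eq_one_left hinv]
    have := conductor_changeLevel (χ := χ₁) hd₁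
    rw [heq, conductor_changeLevel] at this
    rw [← h₁, ← h₂, this]
  · by_cases hc : IsCoprime (n : ℤ) ((q₁ * q₂ : ℕ) : ℤ)
    · have e₁ := changeLevel_eq_cast_of_dvd' χ₁ hd₁ hc
      have e₂ := changeLevel_eq_cast_of_dvd' χ₂ hd₂ hc
      simp only [Int.cast_natCast] at e₁ e₂
      rw [MulChar.mul_apply, e₁, e₂]
    · have e : (changeLevel hd₁ χ₁ * changeLevel hd₂ χ₂) n = 0 := by
        have := (apply_eq_zero_iff (changeLevel hd₁ χ₁ * changeLevel hd₂ χ₂) (n : ℤ)).2 hc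
        simpa only [Int.cast_natCast] using this
      rw [e]
      push_cast at hc
      rw [IsCoprime.mul_right_iff, not_and_or] at hc
      rcases hc with hc | hc
      · have := (apply_eq_zero_iff χ₁ (n : ℤ)).2 hc
        rw [Int.cast_natCast] at this
        rw [this, zero_mul]
      · have := (apply_eq_zero_iff χ₂ (n : ℤ)).2 hc
        rw [Int.cast_natCast] at this
        rw [this, mul_zero]

theorem exists_pow_le_mul_rpow {A δ κ : ℝ} (hA : 1 ≤ A) (hδ0 : 0 ≤ δ) (hδ : δ ≤ κ) (hκ : κ ≤ 1) :
    ∃ N : ℕ, A * (7 / 8) ^ N ≤ 1 ∧ (1 + δ) ^ N ≤ 3 * A ^ (8 * κ) := by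
  have hA0 : 0 < A := by linarith
  have hlA : 0 ≤ Real.log A := Real.log_nonneg hA
  -- The factor 8 is chosen because log(8/7) ≥ 1/8.
  refine ⟨⌈8 * Real.log A⌉₊, ?_, ?_⟩
  · have h1 : 8 * Real.log A ≤ ⌈8 * Real.log A⌉₊ := Nat.le_ceil _
    have h2 : (1 : ℝ) / 8 ≤ Real.log (8 / 7) := by
      have := Real.one_sub_inv_le_log_of_pos (show (0 : ℝ) < 8 / 7 by norm_num)
      norm_num at this ⊢
      linarith
    have h3 : Real.log (7 / 8) ≤ -(1 / 8) := by
      rw [show (7 / 8 : ℝ) = (8 / 7)⁻¹ by norm_num, Real.log_inv]; linarith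
    have h4 : Real.log (A * (7 / 8) ^ ⌈8 * Real.log A⌉₊) ≤ 0 := by
      rw [Real.log_mul hA0.ne' (by positivity), Real.log_pow]
      nlinarith
    rw [Real.log_nonpos_iff (by positivity)] at h4
    exact h4
  · have h1 : (⌈8 * Real.log A⌉₊ : ℝ) ≤ 8 * Real.log A + 1 := (Nat.ceil_lt_add_one (by positivity)).le
    have h2 : (1 + δ) ≤ Real.exp δ := by linarith [Real.add_one_le_exp δ]
    calc (1 + δ) ^ ⌈8 * Real.log A⌉₊ ≤ Real.exp δ ^ ⌈8 * Real.log A⌉₊ := by gcongr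
      _ = Real.exp (⌈8 * Real.log A⌉₊ * δ) := by rw [Real.exp_nat_mul]
      _ ≤ Real.exp (κ + Real.log A * (8 * κ)) := by
        refine Real.exp_le_exp.2 ?_
        calc (⌈8 * Real.log A⌉₊ : ℝ) * δ ≤ (8 * Real.log A + 1) * κ := by gcongr
          _ = _ := by ring
      _ = Real.exp κ * A ^ (8 * κ) := by rw [Real.exp_add, Real.rpow_def_of_pos hA0]
      _ ≤ 3 * A ^ (8 * κ) := by
        gcongr
        exact (Real.exp_le_exp.2 hκ).trans Real.exp_one_lt_three.le

theorem exists_one_add_mul_log_le {κ : ℝ} (hκ : 0 < κ) (a : ℝ) (ha : 0 ≤ a) :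
    ∃ C : ℝ, 0 < C ∧ ∀ x : ℝ, 1 ≤ x → 1 + a * Real.log x ≤ C * x ^ κ := by
  refine ⟨1 + a / κ, by positivity, fun x hx => ?_⟩
  have h1 := Real.log_le_rpow_div (by linarith : 0 ≤ x) hκ
  have h2 := Real.one_le_rpow hx hκ.le
  have h3 : a * Real.log x ≤ a * (x ^ κ / κ) := by gcongr
  calc _ ≤ x ^ κ + a * (x ^ κ / κ) := by linarith
    _ = _ := by ring

/-- A Siegel zero very close to `1` yields a lower bound for `L(1, χ)` for all other characters. -/
theorem IsSiegelZero.exists_le_norm_LFunction_one {q₁ : ℕ} [NeZero q₁] {χ₁ : DirichletCharacter ℂ q₁}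
    {η₁ β₁ κ : ℝ} (h₁ : IsSiegelZero χ₁ η₁ β₁) (hκ0 : 0 < κ) (hκ : κ ≤ 1) (hβ : 1 - β₁ ≤ κ) :
    ∃ c : ℝ, 0 < c ∧ ∀ (q : ℕ) [NeZero q] (χ : DirichletCharacter ℂ q) (η β : ℝ),
      IsSiegelZero χ η β → q ≠ q₁ → c * (q : ℝ) ^ (-(17 * κ)) ≤ ‖χ.LFunction 1‖ := by
  obtain ⟨C, hC1, hC⟩ := exists_one_sub_div_two_le_norm_mul
  obtain ⟨E, hE0, hE⟩ := exists_one_add_mul_log_le hκ0 1 zero_le_one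
  have hq₁ : (1 : ℝ) ≤ q₁ := by exact_mod_cast Nat.pos_of_neZero q₁
  set A : ℝ := ‖χ₁.LFunction 1‖ with hA
  have hA0 : 0 < A := norm_pos_iff.2 (LFunction_apply_one_ne_zero h₁.ne_one)
  have hβ1 : 0 < 1 - β₁ := by linarith [h₁.lt_one]
  let Z : ℝ := A * (3 * E * (q₁ : ℝ) ^ κ) * (3 * (16 * C * (q₁ : ℝ) ^ 2) ^ (8 * κ))
  have hZ0 : 0 < Z := by positivity
  refine ⟨(1 - β₁) / 2 / Z, by positivity, fun q _ χ η β h hq => ?_⟩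
  have hq1 : (1 : ℝ) ≤ q := by exact_mod_cast Nat.pos_of_neZero q
  have hq0 : (0 : ℝ) < q := by linarith
  obtain ⟨ψ, hψ1, hψ⟩ := exists_mul_level_ne_one h₁.isPrimitive h.isPrimitive h.sq_eq_one hq.symm
  -- The requirement on N in `hC` reads X (7/8)^N ≤ 1. Since X grows like q², X^(8κ) contributes
  -- q^(16κ); the remaining q^κ of the exponent 17κ bounds L(1, ψ).
  set X : ℝ := 16 * (C * ((q₁ : ℝ) * q) ^ 2) with hX
  have hX1 : 1 ≤ X := by
    have : (1 : ℝ) ≤ ((q₁ : ℝ) * q) ^ 2 := one_le_pow₀ (one_le_mul_of_one_le_of_one_le hq₁ hq1)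
    nlinarith
  obtain ⟨N, hN1, hN2⟩ := exists_pow_le_mul_rpow hX1 hβ1.le hβ hκ
  have hmain := hC q₁ q χ₁ χ ψ h₁.ne_one h.ne_one hψ1 h₁.sq_eq_one h.sq_eq_one hψ β₁
    (by linarith [h₁.nine_tenths_lt]) h₁.lt_one h₁.LFunction_eq_zero N (by rw [hX] at hN1; linarith)
  have hψn : ‖ψ.LFunction 1‖ ≤ 3 * E * (q₁ : ℝ) ^ κ * (q : ℝ) ^ κ := by
    refine (norm_LFunction_one_le hψ1).trans ?_
    have := hE ((q₁ * q : ℕ) : ℝ) (by push_cast; exact one_le_mul_of_one_le_of_one_le hq₁ hq1)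
    have hlog : 0 ≤ Real.log ((q₁ * q : ℕ) : ℝ) := Real.log_natCast_nonneg _
    have hr : ((q₁ * q : ℕ) : ℝ) ^ κ = (q₁ : ℝ) ^ κ * (q : ℝ) ^ κ := by
      push_cast; rw [Real.mul_rpow (by linarith) (by linarith)]
    rw [hr] at this
    linarith
  have hXr : X ^ (8 * κ) = (16 * C * (q₁ : ℝ) ^ 2) ^ (8 * κ) * (q : ℝ) ^ (16 * κ) := by
    rw [hX, show 16 * (C * ((q₁ : ℝ) * q) ^ 2) = (16 * C * (q₁ : ℝ) ^ 2) * (q : ℝ) ^ (2 : ℝ) by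
      rw [Real.rpow_two]; ring, Real.mul_rpow (by positivity) (by positivity), ← Real.rpow_mul hq0.le]
    ring_nf
  have hfin : (1 - β₁) / 2 ≤ ‖χ.LFunction 1‖ * (Z * (q : ℝ) ^ (17 * κ)) := by
    calc (1 - β₁) / 2 ≤ A * ‖χ.LFunction 1‖ * ‖ψ.LFunction 1‖ * (2 - β₁) ^ N := hmain
      _ ≤ A * ‖χ.LFunction 1‖ * (3 * E * (q₁ : ℝ) ^ κ * (q : ℝ) ^ κ) * (3 * X ^ (8 * κ)) := by
        rw [show 2 - β₁ = 1 + (1 - β₁) by ring]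
        gcongr
      _ = _ := by
        rw [hXr, show 17 * κ = κ + 16 * κ by ring, Real.rpow_add hq0]
        ring
  rw [Real.rpow_neg hq0.le, ← div_eq_mul_inv, div_div, div_le_iff₀ (by positivity)]
  exact hfin

/-- Siegel's bound for the quality of a Siegel zero. -/
theorem exists_quality_mul_log_le_rpow {κ : ℝ} (hκ : 0 < κ) :
    ∃ C : ℝ, 0 < C ∧ ∀ (q : ℕ) [NeZero q] (χ : DirichletCharacter ℂ q) (η β : ℝ),
      IsSiegelZero χ η β → η * Real.log q ≤ C * (q : ℝ) ^ κ := by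
  -- The exponent 19δ is 17δ from the lower bound for L(1, χ) plus 2δ from the squared logarithm;
  -- the cap 1/100 keeps q^(-17δ) well above q^(-4).
  set δ : ℝ := min (κ / 19) (1 / 100) with hδ
  have hδ0 : 0 < δ := by positivity
  have hδκ : 19 * δ ≤ κ := by linarith [min_le_left (κ / 19) (1 / 100 : ℝ)]
  have hδ1 : δ ≤ 1 / 100 := min_le_right _ _
  -- Siegel's dichotomy, the ineffective step: either some Siegel zero lies within δ of 1 and repels
  -- those of every other modulus, or none does and 1/(1-β) < 1/δ always.
  by_cases hex : ∃ (q : ℕ) (_ : NeZero q) (χ : DirichletCharacter ℂ q) (η β : ℝ),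
      IsSiegelZero χ η β ∧ 1 - β ≤ δ
  · obtain ⟨q₁, _, χ₁, η₁, β₁, h₁, hβ₁⟩ := hex
    obtain ⟨c, hc0, hc⟩ := h₁.exists_le_norm_LFunction_one hδ0 (by linarith) hβ₁
    obtain ⟨E, hE0, hE⟩ := exists_one_add_mul_log_le hδ0 6 (by norm_num)
    obtain ⟨q₀, hq₀⟩ := exists_nat_ge (16 / c)
    obtain ⟨C₀, hC₀, hC₀'⟩ := exists_quality_mul_log_le_of_le (max q₀ q₁)
    refine ⟨C₀ + 8 * E ^ 2 / c, by positivity, fun q _ χ η β h => ?_⟩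
    have hq1 : (1 : ℝ) ≤ q := by exact_mod_cast Nat.pos_of_neZero q
    have hq0 : (0 : ℝ) < q := by linarith
    have hqκ : 1 ≤ (q : ℝ) ^ κ := Real.one_le_rpow hq1 hκ.le
    rcases le_or_gt q (max q₀ q₁) with hle | hgt
    · refine (hC₀' q χ η β h hle).trans ?_
      have : 0 ≤ 8 * E ^ 2 / c := by positivity
      nlinarith
    · have hL := hc q χ η β h (by have := le_max_right q₀ q₁; omega)
      have hq₀q : 16 / c ≤ q := hq₀.trans (by
        have := le_max_left q₀ q₁; exact_mod_cast (by omega : q₀ ≤ q))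
      have h16 : 16 * (q : ℝ) ^ (-4 : ℝ) ≤ c * (q : ℝ) ^ (-(17 * δ)) := by
        rw [div_le_iff₀ hc0] at hq₀q
        have h2 : (q : ℝ) ^ (-4 : ℝ) * q ≤ (q : ℝ) ^ (-(17 * δ)) := by
          nth_rw 2 [← Real.rpow_one (q : ℝ)]
          rw [← Real.rpow_add hq0]
          exact Real.rpow_le_rpow_of_exponent_le hq1 (by linarith)
        have h3 : (0 : ℝ) ≤ (q : ℝ) ^ (-4 : ℝ) := by positivity
        calc 16 * (q : ℝ) ^ (-4 : ℝ) ≤ (q * c) * (q : ℝ) ^ (-4 : ℝ) := by gcongr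
          _ = c * ((q : ℝ) ^ (-4 : ℝ) * q) := by ring
          _ ≤ _ := by gcongr
      have hmain := h.quality_mul_log_mul_le (h16.trans hL)
      have hQ0 : 0 < η * Real.log q := by linarith [h.ten_lt]
      have hE2 : (1 + 6 * Real.log q) ^ 2 ≤ E ^ 2 * (q : ℝ) ^ (2 * δ) := by
        have h4 : 0 ≤ 1 + 6 * Real.log q := by linarith [h.one_lt_log]
        calc (1 + 6 * Real.log q) ^ 2 ≤ (E * (q : ℝ) ^ δ) ^ 2 := by
              gcongr; exact hE q hq1
          _ = _ := by rw [mul_pow, two_mul δ, Real.rpow_add hq0]; ring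
      have h5 : η * Real.log q * (c * (q : ℝ) ^ (-(17 * δ))) ≤ 8 * (E ^ 2 * (q : ℝ) ^ (2 * δ)) := by
        calc _ ≤ η * Real.log q * ‖χ.LFunction 1‖ := by gcongr
          _ ≤ _ := hmain.trans (by gcongr)
      rw [Real.rpow_neg hq0.le] at h5
      have h6 : η * Real.log q ≤ 8 * E ^ 2 / c * (q : ℝ) ^ (19 * δ) := by
        rw [show 19 * δ = 2 * δ + 17 * δ by ring, Real.rpow_add hq0]
        have h7 : 0 < (q : ℝ) ^ (17 * δ) := by positivity
        field_simp at h5 ⊢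
        linarith
      have h8 : (q : ℝ) ^ (19 * δ) ≤ (q : ℝ) ^ κ := Real.rpow_le_rpow_of_exponent_le hq1 hδκ
      calc _ ≤ _ := h6
        _ ≤ 8 * E ^ 2 / c * (q : ℝ) ^ κ := by gcongr
        _ ≤ _ := by gcongr; linarith
  · push Not at hex
    refine ⟨1 / δ, by positivity, fun q _ χ η β h => ?_⟩
    have hq1 : (1 : ℝ) ≤ q := by exact_mod_cast Nat.pos_of_neZero q
    have hqκ : 1 ≤ (q : ℝ) ^ κ := Real.one_le_rpow hq1 hκ.le
    have h1 := hex q ‹_› χ η β h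
    rw [← h.one_div_one_sub]
    calc 1 / (1 - β) ≤ 1 / δ := one_div_le_one_div_of_le hδ0 h1.le
      _ ≤ 1 / δ * (q : ℝ) ^ κ := le_mul_of_one_le_right (by positivity) hqκ

/-! ### Slow growth of the sum of r(n)/n beyond z. -/

theorem half_le_natFloor {x : ℝ} (hx : 1 ≤ x) : x / 2 ≤ (⌊x⌋₊ : ℝ) := by
  have h1 := Nat.lt_floor_add_one x
  have h2 : (1 : ℝ) ≤ ⌊x⌋₊ := by exact_mod_cast Nat.floor_pos.2 hx
  linarith

/-- Bernoulli's inequality; it lets the saving z^(-k) pay for the logarithm of the far endpoint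
z^(k+3), making the window bound uniform in k. -/
theorem nat_add_two_le_three_mul_pow {z : ℝ} (hz : 3 / 2 ≤ z) (k : ℕ) : (k : ℝ) + 3 ≤ 3 * z ^ k := by
  have h := one_add_mul_le_pow (show (-2 : ℝ) ≤ 1 / 2 by norm_num) k
  have h2 : (1 + 1 / 2 : ℝ) ^ k ≤ z ^ k := by gcongr; linarith
  have : (0 : ℝ) ≤ k := by positivity
  linarith

/-- The partial sum of `∑ (1 * χ)(n) / n` up to `x`. -/
noncomputable def DirichletCharacter.partialSumZetaMul {q : ℕ} (χ : DirichletCharacter ℂ q) (x : ℝ) : ℝ :=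
  ∑ n ∈ Finset.Ioc 0 ⌊x⌋₊,
    (χ.reCoeff * (ArithmeticFunction.zeta : ArithmeticFunction ℝ)) n * (n : ℝ) ^ (-1 : ℝ)

namespace IsSiegelZero

variable {q : ℕ} [NeZero q] {χ : DirichletCharacter ℂ q} {η β : ℝ}

theorem one_le_partialSumZetaMul (h : IsSiegelZero χ η β) {x : ℝ} (hx : 1 ≤ x) :
    1 ≤ χ.partialSumZetaMul x := by
  have h1 : (1 : ℕ) ∈ Finset.Ioc 0 ⌊x⌋₊ := Finset.mem_Ioc.2 ⟨one_pos, Nat.floor_pos.2 hx⟩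
  have := Finset.single_le_sum (f := fun n : ℕ => (χ.reCoeff *
    (ArithmeticFunction.zeta : ArithmeticFunction ℝ)) n * (n : ℝ) ^ (-1 : ℝ))
    (fun n _ => mul_nonneg (reCoeff_mul_zeta_nonneg h.sq_eq_one n) (by positivity)) h1
  refine le_trans (le_of_eq ?_) this
  rw [reCoeff_mul_zeta_apply, χ.isMultiplicative_zetaMul.map_one]
  simp

/-- Truncation of `L(1, χ)` at any length `≥ ⌊x⌋`, by Pólya–Vinogradov. -/
theorem abs_sum_sub_LFunction_one_le (h : IsSiegelZero χ η β) {x : ℝ} (hx : 1 ≤ x) (N : ℕ)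
    (hN : ⌊x⌋₊ ≤ N) :
    |∑ d ∈ Finset.Ioc 0 N, χ.reCoeff d * (d : ℝ) ^ (-1 : ℝ) - (χ.LFunction 1).re| ≤
      4 * (√q * (1 + Real.log q)) / x := by
  have hB := norm_sum_Icc_le_of_isPrimitive h.isPrimitive h.isQuadratic h.ne_one
  have h1 : 1 ≤ N := (Nat.floor_pos.2 hx).trans_le hN
  have h2 := abs_sum_reCoeff_sub_le h.ne_one hB one_pos h1
  rw [Complex.ofReal_one] at h2
  refine h2.trans ?_
  have hN2 : x / 2 ≤ N := (half_le_natFloor hx).trans (by exact_mod_cast hN)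
  have h3 : (N : ℝ) ^ (-1 : ℝ) ≤ 2 / x := by
    rw [Real.rpow_neg_one, ← one_div, div_le_div_iff₀ (by linarith) (by linarith)]
    linarith
  have h4 : 0 ≤ √q * (1 + Real.log q) := mul_nonneg (Real.sqrt_nonneg _) (by linarith [h.one_lt_log])
  calc _ ≤ 2 * (√q * (1 + Real.log q)) * (2 / x) := by gcongr
    _ = _ := by ring

theorem abs_sum_rpow_neg_le (h : IsSiegelZero χ η β) {x W : ℝ} (hx : 1 ≤ x) (hW : x ^ (1 - β) ≤ W)
    (N : ℕ) (hN : ⌊x⌋₊ ≤ N) :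
    |∑ d ∈ Finset.Ioc 0 N, χ.reCoeff d * (d : ℝ) ^ (-β) - 0| ≤
      4 * (√q * (1 + Real.log q)) / x * W := by
  have hB := norm_sum_Icc_le_of_isPrimitive h.isPrimitive h.isQuadratic h.ne_one
  have h1 : 1 ≤ N := (Nat.floor_pos.2 hx).trans_le hN
  have h2 := abs_sum_reCoeff_sub_le h.ne_one hB (show 0 < β by linarith [h.nine_tenths_lt]) h1
  rw [h.LFunction_eq_zero, Complex.zero_re] at h2
  refine h2.trans ?_
  have hN2 : x / 2 ≤ ⌊x⌋₊ := half_le_natFloor hx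
  have hx0 : (0 : ℝ) < ⌊x⌋₊ := by linarith
  have h3 : (N : ℝ) ^ (-β) ≤ 2 / x * W := by
    calc (N : ℝ) ^ (-β) ≤ (⌊x⌋₊ : ℝ) ^ (-β) :=
          Real.rpow_le_rpow_of_nonpos hx0 (by exact_mod_cast hN) (by linarith [h.nine_tenths_lt])
      _ = (⌊x⌋₊ : ℝ)⁻¹ * (⌊x⌋₊ : ℝ) ^ (1 - β) := by
          rw [← Real.rpow_neg_one, ← Real.rpow_add hx0]; ring_nf
      _ ≤ 2 / x * W := by
          refine mul_le_mul ?_ ?_ (by positivity) (by positivity)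
          · rw [← one_div, div_le_div_iff₀ hx0 (by linarith)]; linarith
          · exact (Real.rpow_le_rpow hx0.le (Nat.floor_le (by linarith)) (by linarith [h.lt_one])).trans hW
  have h4 : 0 ≤ √q * (1 + Real.log q) := mul_nonneg (Real.sqrt_nonneg _) (by linarith [h.one_lt_log])
  calc _ ≤ 2 * (√q * (1 + Real.log q)) * (2 / x * W) := by gcongr
    _ = _ := by ring

end IsSiegelZero

set_option maxHeartbeats 1000000 in
/-- In the presence of a Siegel zero, the sum of `(1 * χ)(n) / n` grows very slowly beyond
`z = q ^ ((1 + ε) / 2)`. -/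
theorem exists_sum_Ioc_zetaMul_le {ε : ℝ} (hε : 0 < ε) :
    ∃ C : ℝ, 0 < C ∧ ∀ (q : ℕ) [NeZero q] (χ : DirichletCharacter ℂ q) (η β : ℝ),
      IsSiegelZero χ η β → ∀ (z : ℝ), z = (q : ℝ) ^ ((1 + ε) / 2) → ∀ k : ℕ,
      ∑ n ∈ Finset.Ioc ⌊z ^ (k + 1)⌋₊ ⌊z ^ (k + 3)⌋₊,
        (χ.reCoeff * (ArithmeticFunction.zeta : ArithmeticFunction ℝ)) n * (n : ℝ) ^ (-1 : ℝ) ≤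
      C * (χ.partialSumZetaMul z / η) := by
  -- With w = q^(1/2+δ) as hyperbola cutoff, z = w q^δ: one q^δ is the gain over √q in
  -- Pólya–Vinogradov, the other the ratio of z to the cutoff.
  set δ : ℝ := ε / 4 with hδ
  have hδ0 : 0 < δ := by positivity
  obtain ⟨CS, hCS0, hCS⟩ := exists_quality_mul_log_le_rpow (half_pos hδ0)
  obtain ⟨Cl, hCl0, hCl⟩ := exists_one_add_mul_log_le (half_pos hδ0) 1 zero_le_one
  set E : ℝ := Real.exp (1 / 2 + δ) with hE
  have hE1 : 1 ≤ E := Real.one_le_exp (by positivity)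
  set M : ℝ := 4 * E * Cl * CS with hM
  have hM0 : 0 < M := by positivity
  refine ⟨(2 + ε) * (1 + 2 * M + 2 + 2 * ((2 + ε) * M) + M) + 8 * CS + 12 * ((2 + ε) * M), by positivity,
    fun q _ χ η β h z hz k => ?_⟩
  have hq3 : (3 : ℝ) ≤ q := by exact_mod_cast h.three_le
  have hq1 : (1 : ℝ) ≤ q := by linarith
  have hq0 : (0 : ℝ) < q := by linarith
  have hl := h.one_lt_log
  set l := Real.log q with hldef
  set Q := η * l with hQ
  have hη := h.quality_pos
  have hQ10 : 10 < Q := h.ten_lt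
  have hηQ : η ≤ Q := le_mul_of_one_le_right hη.le hl.le
  set w : ℝ := (q : ℝ) ^ (1 / 2 + δ) with hw
  have hzw : z = w * (q : ℝ) ^ δ := by
    rw [hz, hw, ← Real.rpow_add hq0, hδ]; ring_nf
  have hw1 : 1 ≤ w := Real.one_le_rpow hq1 (by positivity)
  have hqδ1 : 1 ≤ (q : ℝ) ^ δ := Real.one_le_rpow hq1 hδ0.le
  have hwz : w ≤ z := by rw [hzw]; exact le_mul_of_one_le_right (by linarith) hqδ1
  have hz32 : 3 / 2 ≤ z := by
    refine le_trans ?_ hwz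
    have h1 : √(q : ℝ) ≤ w := by
      rw [Real.sqrt_eq_rpow]; exact Real.rpow_le_rpow_of_exponent_le hq1 (by linarith)
    refine le_trans (Real.le_sqrt_of_sq_le ?_) h1
    norm_num; linarith
  have hz1 : 1 ≤ z := by linarith
  have hz0 : 0 < z := by linarith
  have hlogz : Real.log z = (1 + ε) / 2 * l := by rw [hz, Real.log_rpow hq0]
  set T := χ.partialSumZetaMul z with hT
  have hT1 : 1 ≤ T := h.one_le_partialSumZetaMul hz1
  set L := |(χ.LFunction 1).re| with hL
  set K : ℝ := 4 * E * ((q : ℝ) ^ (-δ) * (1 + l)) with hK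
  have hqneg : (0 : ℝ) < (q : ℝ) ^ (-δ) := by positivity
  have hX0 : 0 ≤ (q : ℝ) ^ (-δ) * (1 + l) := by positivity
  have hεl : 0 < ε * l := by positivity
  have hK0 : 0 ≤ K := by positivity
  have hB : 4 * (√q * (1 + l)) / w = 4 * ((q : ℝ) ^ (-δ) * (1 + l)) := by
    rw [hw, Real.sqrt_eq_rpow, Real.rpow_add hq0, Real.rpow_neg hq0.le]
    field_simp
  have hqq : (q : ℝ) ^ (-δ) * ((q : ℝ) ^ (δ / 2) * (q : ℝ) ^ (δ / 2)) = 1 := by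
    rw [← Real.rpow_add hq0, ← Real.rpow_add hq0]
    simp
  -- The saving q^(-δ) is split in two: one half pays for 1 + log q, the other for Siegel's bound on
  -- Q.
  have hKQ : K * Q ≤ M := by
    have h1 : 1 + l ≤ Cl * (q : ℝ) ^ (δ / 2) := by have := hCl q hq1; rwa [one_mul] at this
    have h2 : Q ≤ CS * (q : ℝ) ^ (δ / 2) := hCS q χ η β h
    calc K * Q ≤ 4 * E * ((q : ℝ) ^ (-δ) * (Cl * (q : ℝ) ^ (δ / 2))) * (CS * (q : ℝ) ^ (δ / 2)) := by
          rw [hK]; gcongr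
      _ = M * ((q : ℝ) ^ (-δ) * ((q : ℝ) ^ (δ / 2) * (q : ℝ) ^ (δ / 2))) := by rw [hM]; ring
      _ = M := by rw [hqq, mul_one]
  have hqδQ : (q : ℝ) ^ (-δ) * Q ≤ CS := by
    have h2 : Q ≤ CS * (q : ℝ) ^ (δ / 2) := hCS q χ η β h
    have h3 : 1 ≤ (q : ℝ) ^ (δ / 2) := Real.one_le_rpow hq1 (by positivity)
    calc (q : ℝ) ^ (-δ) * Q ≤ (q : ℝ) ^ (-δ) * (CS * (q : ℝ) ^ (δ / 2)) := by gcongr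
      _ ≤ (q : ℝ) ^ (-δ) * (CS * (q : ℝ) ^ (δ / 2) * (q : ℝ) ^ (δ / 2)) := by
        gcongr; exact le_mul_of_one_le_right (by positivity) h3
      _ = CS * ((q : ℝ) ^ (-δ) * ((q : ℝ) ^ (δ / 2) * (q : ℝ) ^ (δ / 2))) := by ring
      _ = CS := by rw [hqq, mul_one]
  have hlogz1 : 1 + Real.log z ≤ (2 + ε) * l := by rw [hlogz]; linarith
  clear_value E M w K
  -- the bound for `L(1, χ)`
  have hQL : Q * L ≤ T + 2 * M + 2 + 2 * ((2 + ε) * M) := by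
    have hwβ : w ^ (1 - β) ≤ E := by
      rw [hw, h.rpow_one_sub, hE]
      refine Real.exp_le_exp.2 (div_le_self (by positivity) ?_)
      linarith [h.ten_le_quality]
    have hDY : ⌊w⌋₊ ≤ ⌊z⌋₊ := Nat.floor_le_floor hwz
    have h1 : ∀ N, ⌊w⌋₊ ≤ N → |∑ d ∈ Finset.Ioc 0 N, χ.reCoeff d * (d : ℝ) ^ (-1 : ℝ) -
        (χ.LFunction 1).re| ≤ K := fun N hN => by
      refine (h.abs_sum_sub_LFunction_one_le hw1 N hN).trans ?_
      rw [hB, hK]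
      linarith [le_mul_of_one_le_left hX0 hE1]
    have h2 : ∀ N, ⌊w⌋₊ ≤ N → |∑ d ∈ Finset.Ioc 0 N, χ.reCoeff d * (d : ℝ) ^ (-β) - 0| ≤ K :=
      fun N hN => by
      refine (h.abs_sum_rpow_neg_le hw1 hwβ N hN).trans ?_
      rw [hB, hK]
      apply le_of_eq; ring
    have hmain := abs_div_one_sub_le χ.reCoeff χ.abs_reCoeff_le_one (reCoeff_mul_zeta_nonneg h.sq_eq_one)
      (by linarith [h.nine_tenths_lt]) h.lt_one (Nat.floor_pos.2 hw1) hDY h1 h2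
    have hZpos : (0 : ℝ) < ⌊z⌋₊ := by exact_mod_cast Nat.floor_pos.2 hz1
    rw [div_eq_mul_one_div, h.one_div_one_sub, div_eq_mul_one_div (2 * K) (1 - β),
      h.one_div_one_sub] at hmain
    have h3 : 2 * (⌊w⌋₊ : ℝ) / ⌊z⌋₊ ≤ 2 := by
      rw [div_le_iff₀ hZpos]
      have : (⌊w⌋₊ : ℝ) ≤ ⌊z⌋₊ := by exact_mod_cast hDY
      linarith
    have h4 : 2 * K * (1 + Real.log ⌊z⌋₊) ≤ 2 * ((2 + ε) * M) := by
      have h5 : Real.log ⌊z⌋₊ ≤ Real.log z := Real.log_le_log hZpos (Nat.floor_le hz0.le)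
      have h6 : 1 + Real.log ⌊z⌋₊ ≤ (2 + ε) * Q := by
        have : (2 + ε) * l ≤ (2 + ε) * Q := by
          refine mul_le_mul_of_nonneg_left ?_ (by linarith)
          exact le_mul_of_one_le_left (by linarith) (by linarith [h.ten_le_quality])
        linarith
      calc 2 * K * (1 + Real.log ⌊z⌋₊) ≤ 2 * K * ((2 + ε) * Q) := by gcongr
        _ = 2 * ((2 + ε) * (K * Q)) := by ring
        _ ≤ _ := by gcongr
    have h7 : 2 * K * (η * Real.log q) = 2 * (K * Q) := by rw [hQ, hldef]; ring
    rw [h7] at hmain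
    have h8 : L * (η * Real.log q) = Q * L := by rw [hQ, hldef]; ring
    rw [h8] at hmain
    change Q * L ≤ T + 2 * (K * Q) + _ + _ at hmain
    linarith
  -- the sum over the window
  have hzk : 1 ≤ z ^ k := one_le_pow₀ hz1
  have hzk0 : 0 < z ^ k := by linarith
  -- The cutoff is scaled along with the window, so the truncation error improves to K / z^k.
  have hwk : 1 ≤ w * z ^ k := one_le_mul_of_one_le_of_one_le hw1 hzk
  have hDY : ⌊w * z ^ k⌋₊ ≤ ⌊z ^ (k + 1)⌋₊ := by
    refine Nat.floor_le_floor ?_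
    rw [pow_succ']; gcongr
  have hYY : ⌊z ^ (k + 1)⌋₊ ≤ ⌊z ^ (k + 3)⌋₊ :=
    Nat.floor_le_floor (pow_le_pow_right₀ hz1 (by omega))
  have h1 : ∀ N, ⌊w * z ^ k⌋₊ ≤ N → |∑ d ∈ Finset.Ioc 0 N, χ.reCoeff d * (d : ℝ) ^ (-1 : ℝ) -
      (χ.LFunction 1).re| ≤ K / z ^ k := fun N hN => by
    refine (h.abs_sum_sub_LFunction_one_le hwk N hN).trans ?_
    rw [← div_div, hB]
    gcongr
    rw [hK]
    linarith [le_mul_of_one_le_left hX0 hE1]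
  have hwin := sum_Ioc_mul_zeta_le χ.reCoeff χ.abs_reCoeff_le_one (Nat.floor_pos.2 hwk) hDY hYY h1
  have hzk1 : 1 ≤ z ^ (k + 1) := one_le_pow₀ hz1
  have hYlow : z ^ (k + 1) / 2 ≤ ⌊z ^ (k + 1)⌋₊ := half_le_natFloor hzk1
  have hY0 : (0 : ℝ) < ⌊z ^ (k + 1)⌋₊ := by linarith
  have hY'0 : (0 : ℝ) < ⌊z ^ (k + 3)⌋₊ := by
    have : (⌊z ^ (k + 1)⌋₊ : ℝ) ≤ ⌊z ^ (k + 3)⌋₊ := by exact_mod_cast hYY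
    linarith
  have hY'up : (⌊z ^ (k + 3)⌋₊ : ℝ) ≤ z ^ (k + 3) := Nat.floor_le (by positivity)
  have hKk : K / z ^ k ≤ K := div_le_self hK0 hzk
  have ht1 : Real.log (⌊z ^ (k + 3)⌋₊ / ⌊z ^ (k + 1)⌋₊) ≤ (2 + ε) * l := by
    have h2 : (⌊z ^ (k + 3)⌋₊ : ℝ) / ⌊z ^ (k + 1)⌋₊ ≤ 2 * z ^ 2 := by
      rw [div_le_iff₀ hY0]
      calc (⌊z ^ (k + 3)⌋₊ : ℝ) ≤ z ^ (k + 3) := hY'up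
        _ = 2 * z ^ 2 * (z ^ (k + 1) / 2) := by ring
        _ ≤ _ := by gcongr
    refine (Real.log_le_log (by positivity) h2).trans ?_
    rw [Real.log_mul two_ne_zero (by positivity), Real.log_pow, hlogz]
    have := Real.log_two_lt_d9
    push_cast
    linarith
  have ht2 : 4 * (⌊w * z ^ k⌋₊ : ℝ) / ⌊z ^ (k + 1)⌋₊ ≤ 8 * (q : ℝ) ^ (-δ) := by
    rw [div_le_iff₀ hY0]
    calc 4 * (⌊w * z ^ k⌋₊ : ℝ) ≤ 4 * (w * z ^ k) := by gcongr; exact Nat.floor_le (by positivity)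
      _ = 8 * (q : ℝ) ^ (-δ) * (z ^ (k + 1) / 2) := by
        rw [pow_succ, hzw, Real.rpow_neg hq0.le]; field_simp; norm_num
      _ ≤ _ := by gcongr
  have ht3 : 4 * (K / z ^ k) * (1 + Real.log ⌊z ^ (k + 3)⌋₊) ≤ 12 * K * ((2 + ε) * l) := by
    have h2 : Real.log ⌊z ^ (k + 3)⌋₊ ≤ (k + 3) * Real.log z := by
      refine (Real.log_le_log hY'0 hY'up).trans (le_of_eq ?_)
      rw [Real.log_pow]; push_cast; ring
    have hlz : 0 ≤ Real.log z := Real.log_nonneg hz1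
    have h3 : 1 + Real.log ⌊z ^ (k + 3)⌋₊ ≤ 3 * z ^ k * ((2 + ε) * l) := by
      have h4 := nat_add_two_le_three_mul_pow hz32 k
      calc 1 + Real.log ⌊z ^ (k + 3)⌋₊ ≤ (k + 3) * (1 + Real.log z) := by
            have : (0 : ℝ) ≤ k := by positivity
            linarith
        _ ≤ 3 * z ^ k * ((2 + ε) * l) := by gcongr
    calc _ ≤ 4 * (K / z ^ k) * (3 * z ^ k * ((2 + ε) * l)) := by gcongr
      _ = _ := by field_simp; ring
  rw [mul_div_assoc', le_div_iff₀ hη]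
  have hL0 : 0 ≤ L := abs_nonneg _
  have hU : ∑ n ∈ Finset.Ioc ⌊z ^ (k + 1)⌋₊ ⌊z ^ (k + 3)⌋₊,
      (χ.reCoeff * (ArithmeticFunction.zeta : ArithmeticFunction ℝ)) n * (n : ℝ) ^ (-1 : ℝ) ≤
      (2 + ε) * l * (L + K) + 8 * (q : ℝ) ^ (-δ) + 12 * K * ((2 + ε) * l) := by
    refine hwin.trans (add_le_add (add_le_add ?_ ht2) ht3)
    exact mul_le_mul ht1 (by linarith) (by positivity) (by positivity)
  calc _ ≤ ((2 + ε) * l * (L + K) + 8 * (q : ℝ) ^ (-δ) + 12 * K * ((2 + ε) * l)) * η := by gcongr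
    _ = (2 + ε) * (Q * L + K * Q) + 8 * ((q : ℝ) ^ (-δ) * η) + 12 * ((2 + ε) * (K * Q)) := by
        rw [hQ]; ring
    _ ≤ (2 + ε) * (T + 2 * M + 2 + 2 * ((2 + ε) * M) + M) + 8 * CS + 12 * ((2 + ε) * M) := by
        have : (q : ℝ) ^ (-δ) * η ≤ CS := le_trans (by gcongr) hqδQ
        gcongr
    -- The constant terms are absorbed by T ≥ 1, which comes from n = 1.
    _ ≤ (2 + ε) * ((1 + 2 * M + 2 + 2 * ((2 + ε) * M) + M) * T) + 8 * CS * T + 12 * ((2 + ε) * M) * T := by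
        have e1 : 8 * CS ≤ 8 * CS * T := le_mul_of_one_le_right (by positivity) hT1
        have e2 : 12 * ((2 + ε) * M) ≤ 12 * ((2 + ε) * M) * T := le_mul_of_one_le_right (by positivity) hT1
        have e3 : T + 2 * M + 2 + 2 * ((2 + ε) * M) + M ≤
            (1 + 2 * M + 2 + 2 * ((2 + ε) * M) + M) * T := by
          have : 2 * M + 2 + 2 * ((2 + ε) * M) + M ≤ (2 * M + 2 + 2 * ((2 + ε) * M) + M) * T :=
            le_mul_of_one_le_right (by positivity) hT1
          linarith
        gcongr
    _ = _ := by ring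

/-! ### Multiplication by exceptional primes. -/

section growth

variable {q : ℕ} {χ : DirichletCharacter ℂ q}

-- Only the p-part changes: its geometric sum in χ(p) gains one more term, nonnegative because χ(p)
-- is 0 or 1.
open scoped ComplexOrder in
theorem DirichletCharacter.zetaMul_le_zetaMul_prime_mul (hχ : χ ^ 2 = 1) {p : ℕ} (hp : p.Prime)
    (hχp : χ p ≠ -1) (n : ℕ) : χ.zetaMul n ≤ χ.zetaMul (p * n) := by
  rcases eq_or_ne n 0 with rfl | hn
  · simp
  obtain ⟨v, m, hm, rfl⟩ := Nat.exists_eq_pow_mul_and_not_dvd hn p hp.ne_one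
  have hcop : ∀ k, (p ^ k).Coprime m := fun k =>
    Nat.Coprime.pow_left _ ((Nat.Prime.coprime_iff_not_dvd hp).2 hm)
  have hpow : ∀ k, χ.zetaMul (p ^ k) = ∑ i ∈ Finset.range (k + 1), χ p ^ i := fun k => by
    rw [zetaMul, ArithmeticFunction.coe_zeta_mul_apply, Nat.sum_divisors_prime_pow hp]
    refine Finset.sum_congr rfl fun i _ => ?_
    rw [← apply_eq_toArithmeticFunction_apply χ (pow_ne_zero _ hp.ne_zero), Nat.cast_pow, map_pow]
  rw [← mul_assoc, ← pow_succ', χ.isMultiplicative_zetaMul.map_mul_of_coprime (hcop _),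
    χ.isMultiplicative_zetaMul.map_mul_of_coprime (hcop _)]
  refine mul_le_mul_of_nonneg_right ?_ (zetaMul_nonneg hχ m)
  rw [hpow, hpow, Finset.sum_range_succ _ (v + 1)]
  refine le_add_of_nonneg_right (pow_nonneg ?_ _)
  rcases MulChar.isQuadratic_iff_sq_eq_one.mpr hχ p with h | h | h
  · exact h.ge
  · rw [h]; exact zero_le_one
  · exact absurd h hχp

theorem reCoeff_mul_zeta_le_prod_mul (hχ : χ ^ 2 = 1) {ι : Type*} (s : Finset ι) (t : ι → ℕ)
    (ht : ∀ i ∈ s, IsExceptionalPrime χ (t i)) (n : ℕ) :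
    (χ.reCoeff * (ArithmeticFunction.zeta : ArithmeticFunction ℝ)) n ≤
      (χ.reCoeff * (ArithmeticFunction.zeta : ArithmeticFunction ℝ)) ((∏ i ∈ s, t i) * n) := by
  classical
  induction s using Finset.induction_on with
  | empty => simp
  | insert a s ha ih =>
    rw [Finset.prod_insert ha, mul_assoc]
    refine (ih fun i hi => ht i (Finset.mem_insert_of_mem hi)).trans ?_
    obtain ⟨h1, h2⟩ := ht a (Finset.mem_insert_self a s)
    rw [reCoeff_mul_zeta_apply, reCoeff_mul_zeta_apply]
    exact (Complex.le_def.1 (zetaMul_le_zetaMul_prime_mul hχ h1 h2 _)).1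

open Finset in
/-- Multiplying the integers up to `Y` by `k`-tuples of exceptional primes. -/
theorem sum_pow_mul_sum_le (hχ : χ ^ 2 = 1) (P : Finset ℕ) (hP : ∀ p ∈ P, IsExceptionalPrime χ p)
    {k Y lo hi w : ℕ}
    (hmem : ∀ t : Fin k → ℕ, (∀ i, t i ∈ P) → ∀ n ∈ Ioc 0 Y, (∏ i, t i) * n ∈ Ioc lo hi)
    (hw : ∀ N ∈ Ioc lo hi, #{p ∈ P | p ∣ N} ≤ w) :
    (∑ p ∈ P, 1 / (p : ℝ)) ^ k * ∑ n ∈ Ioc 0 Y,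
      (χ.reCoeff * (ArithmeticFunction.zeta : ArithmeticFunction ℝ)) n * (n : ℝ) ^ (-1 : ℝ) ≤
    (w : ℝ) ^ k * ∑ n ∈ Ioc lo hi,
      (χ.reCoeff * (ArithmeticFunction.zeta : ArithmeticFunction ℝ)) n * (n : ℝ) ^ (-1 : ℝ) := by
  classical
  set r := χ.reCoeff * (ArithmeticFunction.zeta : ArithmeticFunction ℝ) with hr
  have hr0 : ∀ n, 0 ≤ r n := reCoeff_mul_zeta_nonneg hχ
  let g : ℕ → ℝ := fun n => r n * (n : ℝ) ^ (-1 : ℝ)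
  have hg0 : ∀ n, 0 ≤ g n := fun n => mul_nonneg (hr0 n) (by positivity)
  let S := (Fintype.piFinset fun _ : Fin k => P) ×ˢ Ioc 0 Y
  let F : (Fin k → ℕ) × ℕ → ℕ := fun x => (∏ i, x.1 i) * x.2
  have hS {x} (hx : x ∈ S) : (∀ i, x.1 i ∈ P) ∧ x.2 ∈ Ioc 0 Y := by
    obtain ⟨h1, h2⟩ := mem_product.1 hx
    exact ⟨Fintype.mem_piFinset.1 h1, h2⟩
  have h1 : (∑ p ∈ P, 1 / (p : ℝ)) ^ k * ∑ n ∈ Ioc 0 Y, r n * (n : ℝ) ^ (-1 : ℝ) ≤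
      ∑ x ∈ S, g (F x) := by
    rw [sum_pow', sum_mul_sum, ← sum_product']
    refine sum_le_sum fun x hx => ?_
    have h2 := reCoeff_mul_zeta_le_prod_mul hχ univ x.1 (fun i _ => hP _ ((hS hx).1 i)) x.2
    have h3 : (∏ i, 1 / ((x.1 i : ℕ) : ℝ)) * (x.2 : ℝ) ^ (-1 : ℝ) = ((F x : ℕ) : ℝ) ^ (-1 : ℝ) := by
      simp only [F, Real.rpow_neg_one, one_div, Finset.prod_inv_distrib]
      push_cast
      rw [mul_inv]
    calc _ = r x.2 * ((∏ i, 1 / ((x.1 i : ℕ) : ℝ)) * (x.2 : ℝ) ^ (-1 : ℝ)) := by ring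
      _ ≤ g (F x) := by
        rw [h3]
        exact mul_le_mul_of_nonneg_right h2 (by positivity)
  refine h1.trans ?_
  have hmaps : ∀ x ∈ S, F x ∈ Ioc lo hi := fun x hx => hmem x.1 (hS hx).1 x.2 (hS hx).2
  rw [← sum_fiberwise_of_maps_to hmaps, mul_sum]
  refine sum_le_sum fun N hN => ?_
  have hN0 : 0 < N := (Nat.zero_le lo).trans_lt (mem_Ioc.1 hN).1
  -- Given N, the tuple determines n, and every entry of the tuple is one of the at most `w` primes
  -- of `P` dividing N.
  have hcard : #{x ∈ S | F x = N} ≤ w ^ k := by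
    have hle : #{x ∈ S | F x = N} ≤ #(Fintype.piFinset fun _ : Fin k => {p ∈ P | p ∣ N}) := by
      refine card_le_card_of_injOn Prod.fst ?_ ?_
      · intro x hx
        obtain ⟨hx, hxN⟩ := mem_filter.1 (mem_coe.1 hx)
        refine mem_coe.2 (Fintype.mem_piFinset.2 fun i => mem_filter.2 ⟨(hS hx).1 i, ?_⟩)
        rw [← hxN]
        exact (dvd_prod_of_mem _ (mem_univ i)).mul_right _
      · intro x hx y hy hxy
        obtain ⟨hx, hxN⟩ := mem_filter.1 (mem_coe.1 hx)
        obtain ⟨hy, hyN⟩ := mem_filter.1 (mem_coe.1 hy)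
        refine Prod.ext hxy ?_
        have h4 : 0 < ∏ i, x.1 i := prod_pos fun i _ => (hP _ ((hS hx).1 i)).1.pos
        refine Nat.eq_of_mul_eq_mul_left h4 ?_
        change F x = (∏ i, x.1 i) * y.2
        rw [hxN, ← hyN, hxy]
    refine hle.trans ?_
    rw [Fintype.card_piFinset_const]
    exact Nat.pow_le_pow_left (hw N hN) k
  calc ∑ x ∈ S with F x = N, g (F x) = ∑ x ∈ S with F x = N, g N :=
        sum_congr rfl fun x hx => by rw [(mem_filter.1 hx).2]
    _ = #{x ∈ S | F x = N} * g N := by rw [sum_const, nsmul_eq_mul]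
    _ ≤ (w : ℝ) ^ k * g N := by
        refine mul_le_mul_of_nonneg_right ?_ (hg0 N)
        exact_mod_cast hcard

-- Distinct primes dividing N have product at most N, and each exceeds a.
open Finset in
theorem card_filter_dvd_le {P : Finset ℕ} {a : ℝ} (ha : 1 < a) (hP : ∀ p ∈ P, p.Prime)
    (haP : ∀ p ∈ P, a < p) {N w : ℕ} (hN0 : 0 < N) (hN : (N : ℝ) ≤ a ^ w) :
    #{p ∈ P | p ∣ N} ≤ w := by
  have hdvd : ∏ p ∈ P with p ∣ N, p ∣ N :=
    Finset.prod_primes_dvd N (fun p hp => (hP p (mem_filter.1 hp).1).prime)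
      fun p hp => (mem_filter.1 hp).2
  have h1 : a ^ #{p ∈ P | p ∣ N} ≤ N := by
    calc a ^ #{p ∈ P | p ∣ N} = ∏ p ∈ P with p ∣ N, a := by rw [prod_const]
      _ ≤ ∏ p ∈ P with p ∣ N, (p : ℝ) :=
        prod_le_prod (fun _ _ => by linarith) fun p hp => (haP p (mem_filter.1 hp).1).le
      _ ≤ N := by
        rw [← Nat.cast_prod]
        exact Nat.cast_le.2 (Nat.le_of_dvd hN0 hdvd)
  exact (pow_le_pow_iff_right₀ ha).1 (h1.trans hN)

end growth

/-! ### Windows and the final estimates. -/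

section windows

variable {q : ℕ} [NeZero q] {χ : DirichletCharacter ℂ q} {η β C z : ℝ}

/-- A product of k primes from (a, b] lies in (z^(j+1), z^(j+2)], and a further factor n ≤ z keeps
it within z^(j+3). Both sides then carry the partial sum up to z, which is positive and cancels. -/
theorem IsSiegelZero.sum_window_pow_le (h : IsSiegelZero χ η β) (hz : 1 < z)
    {k j : ℕ} (hk : 0 < k) {a b : ℝ} {w : ℕ} (ha : 1 < a) (hak : z ^ (j + 1) ≤ a ^ k)
    (hbk : b ^ k ≤ z ^ (j + 2)) (haw : z ^ (j + 3) ≤ a ^ w)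
    (hC : ∑ n ∈ Finset.Ioc ⌊z ^ (j + 1)⌋₊ ⌊z ^ (j + 3)⌋₊,
        (χ.reCoeff * (ArithmeticFunction.zeta : ArithmeticFunction ℝ)) n * (n : ℝ) ^ (-1 : ℝ) ≤
      C * (χ.partialSumZetaMul z / η)) :
    (∑ p ∈ exceptionalPrimesIoc χ a b, 1 / (p : ℝ)) ^ k ≤ (w : ℝ) ^ k * (C / η) := by
  have hz0 : 0 < z := by linarith
  have hT : 0 < χ.partialSumZetaMul z := zero_lt_one.trans_le (h.one_le_partialSumZetaMul hz.le)
  have hP := fun p => (mem_exceptionalPrimesIoc χ a b p).1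
  have hmain := sum_pow_mul_sum_le (k := k) (Y := ⌊z⌋₊) (lo := ⌊z ^ (j + 1)⌋₊) (hi := ⌊z ^ (j + 3)⌋₊)
    (w := w) h.sq_eq_one (exceptionalPrimesIoc χ a b) (fun p hp => (hP p hp).1) ?_ ?_
  · refine le_of_mul_le_mul_right ?_ hT
    calc _ ≤ _ := hmain
      _ ≤ (w : ℝ) ^ k * (C * (χ.partialSumZetaMul z / η)) := by gcongr
      _ = _ := by ring
  · intro t ht n hn
    obtain ⟨hn0, hnz⟩ := Finset.mem_Ioc.1 hn
    have hn1 : (1 : ℝ) ≤ n := by exact_mod_cast hn0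
    have hnz' : (n : ℝ) ≤ z := (Nat.le_floor_iff hz0.le).1 hnz
    have : Nonempty (Fin k) := ⟨⟨0, hk⟩⟩
    have h1 : a ^ k < ∏ i, (t i : ℝ) := by
      have := Finset.prod_lt_prod_of_nonempty (s := (Finset.univ : Finset (Fin k))) (f := fun _ => a)
        (g := fun i => (t i : ℝ)) (fun _ _ => by linarith) (fun i _ => (hP _ (ht i)).2.1)
        Finset.univ_nonempty
      simpa using this
    have h2 : ∏ i, (t i : ℝ) ≤ b ^ k := by
      have := Finset.prod_le_prod (s := (Finset.univ : Finset (Fin k))) (f := fun i => (t i : ℝ))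
        (g := fun _ => b) (fun _ _ => by positivity) (fun i _ => (hP _ (ht i)).2.2)
      simpa using this
    rw [Finset.mem_Ioc, Nat.floor_lt (by positivity), Nat.le_floor_iff (by positivity)]
    push_cast
    have h3 : 0 < ∏ i, (t i : ℝ) := (pow_pos (by linarith) k).trans h1
    constructor
    · nlinarith
    · calc (∏ i, (t i : ℝ)) * n ≤ z ^ (j + 2) * z := by
            gcongr
            exact h2.trans hbk
        _ = z ^ (j + 3) := by ring
  · intro N hN
    obtain ⟨hlo, hhi⟩ := Finset.mem_Ioc.1 hN
    exact card_filter_dvd_le ha (fun p hp => (hP p hp).1.1) (fun p hp => (hP p hp).2.1)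
      ((Nat.zero_le _).trans_lt hlo) (((Nat.le_floor_iff (by positivity)).1 hhi).trans haw)

theorem sum_exceptionalPrimesIoc_le_add {q : ℕ} (χ : DirichletCharacter ℂ q) (a b c : ℝ) :
    ∑ p ∈ exceptionalPrimesIoc χ a c, 1 / (p : ℝ) ≤
      ∑ p ∈ exceptionalPrimesIoc χ a b, 1 / (p : ℝ) + ∑ p ∈ exceptionalPrimesIoc χ b c, 1 / (p : ℝ) := by
  classical
  rw [← Finset.sum_union_inter]
  refine le_add_of_le_of_nonneg (Finset.sum_le_sum_of_subset_of_nonneg (fun p hp => ?_)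
    fun _ _ _ => by positivity) (Finset.sum_nonneg fun _ _ => by positivity)
  rw [Finset.mem_union]
  simp only [mem_exceptionalPrimesIoc] at hp ⊢
  rcases le_or_gt (p : ℝ) b with h | h
  · exact Or.inl ⟨hp.1, hp.2.1, h⟩
  · exact Or.inr ⟨hp.1, h, hp.2.2⟩

theorem sum_exceptionalPrimesIoc_pow_le {q : ℕ} (χ : DirichletCharacter ℂ q) {A : ℝ}
    (hA : ∀ j : ℕ, ∑ p ∈ exceptionalPrimesIoc χ (z ^ (j + 1)) (z ^ (j + 2)), 1 / (p : ℝ) ≤ A) (J : ℕ) :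
    ∑ p ∈ exceptionalPrimesIoc χ z (z ^ (J + 1)), 1 / (p : ℝ) ≤ J * A := by
  induction J with
  | zero =>
    rw [Finset.sum_eq_zero]
    · simp
    · intro p hp
      obtain ⟨-, h1, h2⟩ := (mem_exceptionalPrimesIoc χ _ _ p).1 hp
      simp only [zero_add, pow_one] at h2
      linarith
  | succ J ih =>
    refine (sum_exceptionalPrimesIoc_le_add χ z (z ^ (J + 1)) _).trans ?_
    push_cast
    linarith [hA J]

end windows

theorem proposition3p5 (ε : ℝ) (hε : 0 < ε) :
    ∃ C : ℝ, 0 < C ∧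
      ∀ (q : ℕ) [NeZero q] (χ : DirichletCharacter ℂ q) (η β : ℝ), IsSiegelZero χ η β →
        (∀ x : ℝ, (q : ℝ) ^ ((1 + ε) / 2) ≤ x →
          ∑ p ∈ exceptionalPrimesIoc χ ((q : ℝ) ^ ((1 + ε) / 2)) x, 1 / (p : ℝ)
            ≤ C * (Real.logb q x / η)) ∧
        (∀ m : ℕ, 2 ≤ m →
          ∑ p ∈ exceptionalPrimesIoc χ ((q : ℝ) ^ ((1 + ε) / (2 * (m : ℝ))))
              ((q : ℝ) ^ ((1 + ε) / (2 * ((m : ℝ) - 1)))), 1 / (p : ℝ)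
            ≤ C * ((m : ℝ) / η ^ (1 / (m : ℝ)))) := by
  obtain ⟨C, hC0, hC⟩ := exists_sum_Ioc_zetaMul_le hε
  refine ⟨6 * (1 + C), by positivity, fun q _ χ η β h => ?_⟩
  have hq3 : (3 : ℝ) ≤ q := by exact_mod_cast h.three_le
  have hq1 : (1 : ℝ) < q := by linarith
  have hq0 : (0 : ℝ) < q := by linarith
  have hη := h.quality_pos
  set z : ℝ := (q : ℝ) ^ ((1 + ε) / 2) with hz
  have hz1 : 1 < z := Real.one_lt_rpow hq1 (by positivity)
  have hz0 : 0 < z := by linarith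
  have hlogq : 0 < Real.log q := by linarith [h.one_lt_log]
  constructor
  · intro x hx
    have hx0 : 0 < x := by linarith
    -- Here `w` = 3 because j + 3 ≤ 3 (j + 1).
    have hA (j : ℕ) : ∑ p ∈ exceptionalPrimesIoc χ (z ^ (j + 1)) (z ^ (j + 2)), 1 / (p : ℝ) ≤
        3 * (C / η) := by
      have := h.sum_window_pow_le hz1 (k := 1) (j := j) (a := z ^ (j + 1)) (b := z ^ (j + 2)) (w := 3)
        one_pos (one_lt_pow₀ hz1 (by omega)) (by simp) (by simp)
        (by rw [← pow_mul]; exact pow_le_pow_right₀ hz1.le (by omega)) (hC q χ η β h z hz j)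
      simpa using this
    set J := ⌊Real.log x / Real.log z⌋₊ with hJ
    have hlogz : Real.log z = (1 + ε) / 2 * Real.log q := by rw [hz, Real.log_rpow hq0]
    have hlogz0 : 0 < Real.log z := Real.log_pos hz1
    have hlogx : 0 ≤ Real.log x := Real.log_nonneg (by linarith)
    have hxJ : x ≤ z ^ (J + 1) := by
      rw [← Real.log_le_log_iff hx0 (by positivity), Real.log_pow, ← div_le_iff₀ hlogz0]
      push_cast
      exact (Nat.lt_floor_add_one _).le
    have hJx : (J : ℝ) ≤ 2 * Real.logb q x := by
      refine (Nat.floor_le (by positivity)).trans ?_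
      rw [Real.logb, hlogz, div_le_iff₀ (by positivity)]
      have : 2 * (Real.log x / Real.log q) * ((1 + ε) / 2 * Real.log q) = (1 + ε) * Real.log x := by
        field_simp
      rw [this]
      nlinarith
    have hsub : ∑ p ∈ exceptionalPrimesIoc χ z x, 1 / (p : ℝ) ≤
        ∑ p ∈ exceptionalPrimesIoc χ z (z ^ (J + 1)), 1 / (p : ℝ) := by
      refine Finset.sum_le_sum_of_subset_of_nonneg (fun p hp => ?_) fun _ _ _ => by positivity
      rw [mem_exceptionalPrimesIoc] at hp ⊢
      exact ⟨hp.1, hp.2.1, hp.2.2.trans hxJ⟩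
    have hlogb : 0 ≤ Real.logb q x := Real.logb_nonneg hq1 (by linarith)
    calc _ ≤ _ := hsub
      _ ≤ J * (3 * (C / η)) := sum_exceptionalPrimesIoc_pow_le χ hA J
      _ ≤ 2 * Real.logb q x * (3 * (C / η)) := by gcongr
      _ = 6 * C * (Real.logb q x / η) := by ring
      _ ≤ _ := by gcongr; linarith
  · intro m hm
    have hm2 : (2 : ℝ) ≤ m := by exact_mod_cast hm
    have hm0 : (0 : ℝ) < m := by linarith
    set a : ℝ := (q : ℝ) ^ ((1 + ε) / (2 * (m : ℝ))) with ha
    set b : ℝ := (q : ℝ) ^ ((1 + ε) / (2 * ((m : ℝ) - 1))) with hb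
    have ham : a ^ m = z := by
      rw [ha, hz, ← Real.rpow_mul_natCast hq0.le]; congr 1; field_simp
    -- The exponent m/(m-1) is at most 2 for m ≥ 2, so the single window from z to z³ suffices.
    have hbm : b ^ m ≤ z ^ 2 := by
      rw [hb, hz, ← Real.rpow_mul_natCast hq0.le, ← Real.rpow_mul_natCast hq0.le]
      refine Real.rpow_le_rpow_of_exponent_le hq1.le ?_
      have hm1 : (0 : ℝ) < m - 1 := by linarith
      rw [div_mul_eq_mul_div, div_le_iff₀ (by positivity)]
      push_cast
      nlinarith
    have hmain := h.sum_window_pow_le hz1 (k := m) (j := 0) (a := a) (b := b) (w := 3 * m)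
      (by omega) (Real.one_lt_rpow hq1 (by positivity)) (by rw [ham]; simp) (by simpa using hbm)
      (by rw [mul_comm, pow_mul, ham]) (hC q χ η β h z hz 0)
    set S := ∑ p ∈ exceptionalPrimesIoc χ a b, 1 / (p : ℝ) with hS
    have hS0 : 0 ≤ S := Finset.sum_nonneg fun _ _ => by positivity
    -- Replacing C by (1 + C)^m keeps the constant independent of m after the m-th root.
    have hCle : C ≤ (1 + C) ^ m := by
      calc C ≤ (1 + C) ^ 1 := by linarith
        _ ≤ (1 + C) ^ m := pow_le_pow_right₀ (by linarith) (by omega)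
    have hηm : (η ^ (1 / (m : ℝ))) ^ m = η := by
      rw [← Real.rpow_mul_natCast hη.le, one_div, inv_mul_cancel₀ hm0.ne', Real.rpow_one]
    have hle : S ^ m ≤ (3 * (1 + C) * (m / η ^ (1 / (m : ℝ)))) ^ m := by
      calc S ^ m ≤ ((3 * m : ℕ) : ℝ) ^ m * (C / η) := hmain
        _ ≤ ((3 * m : ℕ) : ℝ) ^ m * ((1 + C) ^ m / η) := by gcongr
        _ = _ := by
          rw [mul_pow, mul_pow, div_pow, hηm]; push_cast; rw [mul_pow]; ring
    have hpos : 0 ≤ m / η ^ (1 / (m : ℝ)) := by positivity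
    calc S ≤ 3 * (1 + C) * (m / η ^ (1 / (m : ℝ))) :=
          le_of_pow_le_pow_left₀ (by omega) (by positivity) hle
      _ ≤ _ := by gcongr; linarith
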